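/- **Theorem 1.1.** A monic polynomial $f\in\mathbb Z[x]$ is called monogenic if it is irreducible over $\mathbb Q$ and, for a root $\theta$ of $f$ and $K=\mathbb Q(\theta)$, the ring of integers of $K$ equals $\mathbb Z[\theta]$. Let $n\ge 2$ be an integer, let $m\ge 1$ be a proper divisor of $n$ (so $m<n$), and let $t=n/m$. Let $\kappa$ denote the squarefree kernel of $m$, i.e. the product of the distinct primes dividing $m$. Then the product over primes $\prod_{p\,\nmid\, t(t-1)\kappa}\left(1-\frac1{p^2-1}\right)$ converges unconditionally. For real $X\ge 1$ put $$M(X)=\frac{X}{\kappa\,\zeta(2)}\prod_{p\,\mid\,\kappa}\left(1-\frac1{p+1}\right)\prod_{p\,\nmid\, t(t-1)\kappa}\left(1-\frac1{p^2-1}\right).$$ (a) The number of positive integers $A\le X$ such that $A\equiv 0\pmod{\kappa}$ and $x^n+Ax^m+A$ is monogenic equals $M(X)+O(X^{3/4})$. (b) If $n\ge 3$, then the number of positive integers $A\le X$ such that $A\equiv 0\pmod{\kappa}$ and $x^n+Ax^m+A$ is monogenic with non-squarefree discriminant also equals $M(X)+O(X^{3/4})$. The estimates hold for all real $X\ge 1$,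 and the implied constants depend only on $n$ and $m$. -/

import Mathlib

open Polynomial

noncomputable section

/-- A monic integer polynomial `f` is monogenic if it is irreducible over `ℚ` and, for the root `θ`
of `f` in the number field `K = ℚ[x]/(f) = ℚ(θ)`, the ring of integers of `K` (the integral closure
of `ℤ` in `K`) equals `ℤ[θ]`. -/
def IsMonogenicPoly (f : ℤ[X]) : Prop :=
  f.Monic ∧
  Irreducible (f.map (Int.castRingHom ℚ)) ∧
  integralClosure ℤ (AdjoinRoot (f.map (Int.castRingHom ℚ))) =
    Algebra.adjoin ℤ {AdjoinRoot.root (f.map (Int.castRingHom ℚ))}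

/-- The trinomial `x ^ n + A x ^ m + A` with integer coefficients. -/
def trinomialAA (n m A : ℕ) : ℤ[X] :=
  X ^ n + C (A : ℤ) * X ^ m + C (A : ℤ)

/-- The squarefree kernel of `m`: the product of the distinct primes dividing `m`. -/
def squarefreeKernel (m : ℕ) : ℕ := UniqueFactorizationMonoid.radical m

/-- The factor at `p` of the infinite product. -/
def eulerFactor (p : ℕ) : ℝ := 1 - 1 / ((p : ℝ) ^ 2 - 1)

/-- The primes `p` that do not divide `t (t - 1) κ`, where `t = n / m` and `κ` is the squarefree
kernel of `m`. -/
def outerPrimes (n m : ℕ) : Set ℕ :=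
  {p | p.Prime ∧ ¬ p ∣ (n / m) * (n / m - 1) * squarefreeKernel m}

/-- The constant
`1 / (κ ζ(2)) * ∏_{p ∣ κ} (1 - 1 / (p + 1)) * ∏_{p ∤ t (t - 1) κ} (1 - 1 / (p ^ 2 - 1))`
with `t = n / m` and `κ` the squarefree kernel of `m`. -/
def densityConst (n m : ℕ) : ℝ :=
  1 / ((squarefreeKernel m : ℝ) * (riemannZeta 2).re) *
    (∏ p ∈ (squarefreeKernel m).primeFactors, (1 - 1 / ((p : ℝ) + 1))) *
    ∏' p : outerPrimes n m, eulerFactor (p : ℕ)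

/-- The number of positive integers `A ≤ X` divisible by the squarefree kernel of `m` such that
`x ^ n + A x ^ m + A` is monogenic. -/
def countMonogenic (n m : ℕ) (X : ℝ) : ℕ :=
  Set.ncard {A : ℕ | 0 < A ∧ (A : ℝ) ≤ X ∧ squarefreeKernel m ∣ A ∧
    IsMonogenicPoly (trinomialAA n m A)}

/-- The number of positive integers `A ≤ X` divisible by the squarefree kernel of `m` such that
`x ^ n + A x ^ m + A` is monogenic and its discriminant is not squarefree. -/
def countMonogenicNonSquarefree (n m : ℕ) (X : ℝ) : ℕ :=
  Set.ncard {A : ℕ | 0 < A ∧ (A : ℝ) ≤ X ∧ squarefreeKernel m ∣ A ∧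
    IsMonogenicPoly (trinomialAA n m A) ∧ ¬ Squarefree (trinomialAA n m A).discr}

end

/-! Put t = n/m, g(y) = y^t + Ay + A, so that the trinomial is f = g(x^m), and D = t^t + (1-t)^(t-1)
A. For κ ∣ A and A ≥ 2, f is monogenic iff A is squarefree and p² ∤ D for every prime p ∤ t(t-1)κ.
At p ∣ A, f is Eisenstein if p² ∤ A, while θ^(n-1)/p is integral if p² ∣ A. At p ∤ A (hence p ∤ m)
the only possible multiple root of g modulo p is c = t/(1-t), and (1-t)^t g(c) = D; the Taylor
expansion of g at c turns Dedekind's criterion into p² ∤ D. Such p dividing t(t-1) never obstruct: f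
is separable mod p if p ∣ t-1, and p ∤ D if p ∣ t. See `isMonogenicPoly_trinomialAA`,
`not_isMonogenicPoly_of_sq_dvd` and `not_isMonogenicPoly_of_sq_dvd_discr`.

It remains to count A ≤ X with A and D free of the relevant squares
(`exists_abs_card_sievedSet_sub_le`). Both conditions are opened by Möbius sums over d² ∣ A and e² ∣
D. Truncating d at Z = X^(1/4) costs O(X/Z); e runs to E ≍ X^(1/2), and each of the ZE pairs
contributes its density up to O(1), so both errors are O(X^(3/4)). The densities sum to an Euler
product, which is the stated constant (`tsum_sieveWeight_eq`).

For (b), A^(n-1) divides the discriminant, so for n ≥ 3 it is squarefree for no A ≥ 2 and the same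
count applies. -/

/-! ### Integral elements and reduction modulo p -/

/-- Multiplying an integral equation of `x` by a power of `w` shows that `w * x` is nilpotent modulo
`w S`. This is the only way integrality enters Dedekind's criterion below. -/
theorem exists_pow_mul_eq_mul_of_isIntegral {K : Type*} [CommRing K] (S : Subalgebra ℤ K)
    {x w : K} (hx : IsIntegral ℤ x) (hw : w ∈ S) (hwx : w * x ∈ S) :
    ∃ k : ℕ, ∃ z ∈ S, (w * x) ^ k = w * z := by
  obtain ⟨P, hP, hPx⟩ := hx
  refine ⟨P.natDegree, -∑ i ∈ Finset.range P.natDegree,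
    algebraMap ℤ K (P.coeff i) * w ^ (P.natDegree - 1 - i) * (w * x) ^ i, ?_, ?_⟩
  · exact S.neg_mem (S.sum_mem fun i _ => S.mul_mem (S.mul_mem (S.algebraMap_mem _)
      (S.pow_mem hw _)) (S.pow_mem hwx _))
  · rw [eval₂_eq_sum_range, Finset.sum_range_succ, hP.coeff_natDegree, map_one, one_mul] at hPx
    have h := congrArg (w ^ P.natDegree * ·) hPx
    simp only [mul_add, mul_zero, Finset.mul_sum] at h
    rw [mul_pow, eq_neg_of_add_eq_zero_right h, mul_neg, Finset.mul_sum]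
    congr 1
    refine Finset.sum_congr rfl fun i hi => ?_
    have hi' := Finset.mem_range.1 hi
    obtain ⟨j, hj⟩ : ∃ j, P.natDegree = j + 1 + i := ⟨P.natDegree - 1 - i, by omega⟩
    rw [hj, show j + 1 + i - 1 - i = j by omega]
    ring

theorem dvd_of_squarefree_of_dvd_pow {R : Type*} [CommMonoidWithZero R] [DecompositionMonoid R]
    {x y : R} {k : ℕ} (hx : Squarefree x) (h : x ∣ y ^ k) : x ∣ y := by
  rcases eq_or_ne k 0 with rfl | hk
  · exact (isUnit_of_dvd_one (by simpa using h)).dvd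
  · exact (hx.dvd_pow_iff_dvd hk).1 h

theorem C_dvd_iff_map_zmod_eq_zero (p : ℕ) (g : ℤ[X]) :
    C (p : ℤ) ∣ g ↔ g.map (Int.castRingHom (ZMod p)) = 0 := by
  rw [C_dvd_iff_dvd_coeff, Polynomial.ext_iff]
  simp [ZMod.intCast_zmod_eq_zero_iff_dvd, ZMod.intCast_zmod_eq_zero_iff_dvd]

theorem map_zmod_surjective (p : ℕ) :
    Function.Surjective (Polynomial.map (Int.castRingHom (ZMod p))) :=
  Polynomial.map_surjective _ (ZMod.ringHom_surjective _)

/-- Divisibility modulo `p`, lifted to `ℤ[X]`. -/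
theorem exists_eq_mul_add_of_map_dvd {p : ℕ} {f g : ℤ[X]}
    (h : f.map (Int.castRingHom (ZMod p)) ∣ g.map (Int.castRingHom (ZMod p))) :
    ∃ s r : ℤ[X], g = f * s + C (p : ℤ) * r := by
  obtain ⟨s, hs⟩ := h
  obtain ⟨s, rfl⟩ := map_zmod_surjective p s
  have : C (p : ℤ) ∣ g - f * s := by
    rw [C_dvd_iff_map_zmod_eq_zero, Polynomial.map_sub, Polynomial.map_mul, hs, sub_self]
  obtain ⟨r, hr⟩ := this
  exact ⟨s, r, by rw [← hr]; ring⟩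

/-! ### Dedekind's criterion at a prime, and its globalisation -/

section Root

variable {f : ℤ[X]}

theorem aeval_root_eq_zero_iff (hf : f.Monic) (g : ℤ[X]) :
    aeval (AdjoinRoot.root (f.map (Int.castRingHom ℚ))) g = 0 ↔ f ∣ g := by
  rw [← Polynomial.map_dvd_map (Int.castRingHom ℚ) (RingHom.injective_int _) hf,
    ← AdjoinRoot.mk_eq_zero, ← AdjoinRoot.aeval_eq, ← algebraMap_int_eq, aeval_map_algebraMap]

theorem mem_adjoin_root_iff {x : AdjoinRoot (f.map (Int.castRingHom ℚ))} :
    x ∈ Algebra.adjoin ℤ {AdjoinRoot.root (f.map (Int.castRingHom ℚ))} ↔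
      ∃ g : ℤ[X], aeval (AdjoinRoot.root (f.map (Int.castRingHom ℚ))) g = x := by
  rw [Algebra.adjoin_singleton_eq_range_aeval]
  rfl

theorem isIntegral_root (hf : f.Monic) :
    IsIntegral ℤ (AdjoinRoot.root (f.map (Int.castRingHom ℚ))) :=
  ⟨f, hf, by rw [← aeval_def, aeval_root_eq_zero_iff hf]⟩

theorem isIntegral_aeval_root (hf : f.Monic) (g : ℤ[X]) :
    IsIntegral ℤ (aeval (AdjoinRoot.root (f.map (Int.castRingHom ℚ))) g) := by
  have := adjoin_le_integralClosure (isIntegral_root hf)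
  exact this (mem_adjoin_root_iff.2 ⟨g, rfl⟩)

/-- If the square of a monic polynomial of smaller degree is `0` modulo `(f, p ^ 2)`, then `f` is
not monogenic. -/
theorem not_isMonogenicPoly_of_sq_eq {p : ℕ} (hp : p.Prime) {g s r : ℤ[X]} (hg : g.Monic)
    (hdeg : g.natDegree < f.natDegree) (h : g ^ 2 = f * s + C (p : ℤ) ^ 2 * r) :
    ¬ IsMonogenicPoly f := by
  rintro ⟨hf, hirr, hcl⟩
  have : Fact (Irreducible (f.map (Int.castRingHom ℚ))) := ⟨hirr⟩
  have : Fact p.Prime := ⟨hp⟩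
  set θ := AdjoinRoot.root (f.map (Int.castRingHom ℚ)) with hθ
  have hp0 : (p : AdjoinRoot (f.map (Int.castRingHom ℚ))) ≠ 0 := Nat.cast_ne_zero.2 hp.ne_zero
  have hfθ : aeval θ f = 0 := (aeval_root_eq_zero_iff hf f).2 dvd_rfl
  -- The element g(θ)/p is integral because its square is r(θ). Were it in ℤ[θ], f would divide g
  -- modulo p, against the degrees.
  have hsq : (aeval θ g / p) ^ 2 = aeval θ r := by
    have := congrArg (aeval θ) h
    simp only [map_pow, map_add, map_mul, hfθ, zero_mul, zero_add, aeval_C] at this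
    rw [div_pow, this]
    field_simp
    simp [mul_comm]
  have hint : IsIntegral ℤ (aeval θ g / p) :=
    IsIntegral.of_pow two_pos (hsq ▸ isIntegral_aeval_root hf r)
  have hmem : aeval θ g / p ∈ integralClosure ℤ (AdjoinRoot (f.map (Int.castRingHom ℚ))) := hint
  rw [hcl] at hmem
  obtain ⟨q, hq⟩ := mem_adjoin_root_iff.1 hmem
  have hdvd : f ∣ g - C (p : ℤ) * q := by
    rw [← aeval_root_eq_zero_iff hf, map_sub, map_mul, ← hθ, hq, aeval_C]
    field_simp
    simp
  have hdvd' := Polynomial.map_dvd (Int.castRingHom (ZMod p)) hdvd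
  rw [Polynomial.map_sub, Polynomial.map_mul, (C_dvd_iff_map_zmod_eq_zero p _).1 dvd_rfl, zero_mul,
    sub_zero] at hdvd'
  refine (hf.map (Int.castRingHom (ZMod p))).not_dvd_of_natDegree_lt
    (hg.map (Int.castRingHom (ZMod p))).ne_zero ?_ hdvd'
  rwa [hg.natDegree_map, hf.natDegree_map]

/-- `ℤ[θ]` is maximal at `p`: an integral element `x` with `p x ∈ ℤ[θ]` lies in `ℤ[θ]`. -/
def MaximalAt (f : ℤ[X]) (p : ℕ) : Prop :=
  ∀ x : AdjoinRoot (f.map (Int.castRingHom ℚ)), IsIntegral ℤ x →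
    (p : AdjoinRoot (f.map (Int.castRingHom ℚ))) * x ∈
      Algebra.adjoin ℤ {AdjoinRoot.root (f.map (Int.castRingHom ℚ))} →
    x ∈ Algebra.adjoin ℤ {AdjoinRoot.root (f.map (Int.castRingHom ℚ))}

/-- Dedekind's criterion for `f = u ^ 2 v + p F`, where `u v` is squarefree modulo `p` and `F` is
coprime to `u` modulo `p`. -/
theorem maximalAt_of_eq_sq_mul_add (hf : f.Monic) (hirr : Irreducible (f.map (Int.castRingHom ℚ)))
    {p : ℕ} (hp : p.Prime) {u v F : ℤ[X]} (hfuv : f = u ^ 2 * v + C (p : ℤ) * F)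
    (hsq : Squarefree ((u * v).map (Int.castRingHom (ZMod p))))
    (hcop : IsCoprime (u.map (Int.castRingHom (ZMod p))) (F.map (Int.castRingHom (ZMod p)))) :
    MaximalAt f p := by
  intro x hx hpx
  have : Fact (Irreducible (f.map (Int.castRingHom ℚ))) := ⟨hirr⟩
  have : Fact p.Prime := ⟨hp⟩
  set θ := AdjoinRoot.root (f.map (Int.castRingHom ℚ)) with hθ
  set S := Algebra.adjoin ℤ {θ} with hS
  set φ := Polynomial.map (Int.castRingHom (ZMod p)) with hφ
  have hp0 : (p : AdjoinRoot (f.map (Int.castRingHom ℚ))) ≠ 0 := Nat.cast_ne_zero.2 hp.ne_zero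
  have hfθ : aeval θ f = 0 := (aeval_root_eq_zero_iff hf f).2 dvd_rfl
  have hCp : ∀ q : ℤ[X], φ (C (p : ℤ) * q) = 0 := fun q =>
    (C_dvd_iff_map_zmod_eq_zero p _).1 (dvd_mul_right _ _)
  have hφf : φ f = φ u ^ 2 * φ v := by
    conv_lhs => rw [hfuv]
    rw [hφ, Polynomial.map_add, ← hφ, hCp, add_zero, hφ, Polynomial.map_mul, Polynomial.map_pow]
  have hmapuv : φ (u * v) = φ u * φ v := Polynomial.map_mul _
  have hrel : aeval θ u ^ 2 * aeval θ v = -(p * aeval θ F) := by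
    have := congrArg (aeval θ) hfuv
    simp only [hfθ, map_add, map_mul, map_pow, aeval_C] at this
    rw [eq_neg_iff_add_eq_zero, this]
    simp
  -- `p x` is nilpotent modulo `p`, hence divisible by `u v` modulo `p`
  obtain ⟨g, hg⟩ := mem_adjoin_root_iff.1 hpx
  obtain ⟨k, z, hz, hkz⟩ := exists_pow_mul_eq_mul_of_isIntegral S hx
    (natCast_mem S p) hpx
  obtain ⟨z, rfl⟩ := mem_adjoin_root_iff.1 hz
  have h1 : f ∣ g ^ k - C (p : ℤ) * z := by
    rw [← aeval_root_eq_zero_iff hf, map_sub, map_mul, map_pow, hg, hkz, aeval_C]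
    simp
  have h2 : φ (u * v) ∣ φ g := by
    have h := Polynomial.map_dvd (Int.castRingHom (ZMod p)) h1
    rw [Polynomial.map_sub, ← hφ, hCp, sub_zero, hφ, Polynomial.map_pow, ← hφ, hφf] at h
    have h' : φ (u * v) ∣ φ g ^ k := (Dvd.intro (φ u) (by rw [hmapuv]; ring)).trans h
    exact (dvd_of_squarefree_of_dvd_pow hsq h')
  obtain ⟨s, w, hsw⟩ := exists_eq_mul_add_of_map_dvd h2
  -- replace `x` by `x - w(θ)`
  set y := x - aeval θ w with hy
  have hyint : IsIntegral ℤ y := hx.sub (isIntegral_aeval_root hf w)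
  have hpy : p * y = aeval θ (u * v * s) := by
    have := congrArg (aeval θ) hsw
    rw [map_add, hg, map_mul (aeval θ) (C (p : ℤ)), aeval_C] at this
    rw [hy, mul_sub, this]
    simp
  -- At θ, u · py = u²v s = -pF s. So u(θ)y lies in ℤ[θ] and the nilpotence argument applies again,
  -- now with w = u(θ).
  have huy : aeval θ u * y = aeval θ (-(F * s)) := by
    apply mul_left_cancel₀ hp0
    rw [mul_left_comm, hpy]
    simp only [map_mul, map_neg]
    linear_combination aeval θ s * hrel
  obtain ⟨l, z', hz', hlz⟩ := exists_pow_mul_eq_mul_of_isIntegral S hyint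
    (mem_adjoin_root_iff.2 ⟨u, rfl⟩) (mem_adjoin_root_iff.2 ⟨_, huy.symm⟩)
  obtain ⟨z', rfl⟩ := mem_adjoin_root_iff.1 hz'
  have h3 : f ∣ (-(F * s)) ^ l - u * z' := by
    rw [← aeval_root_eq_zero_iff hf, map_sub, map_mul, map_pow, ← hθ, ← huy, hlz, sub_self]
  have husq : Squarefree (φ u) := hsq.squarefree_of_dvd (by rw [hmapuv]; exact dvd_mul_right _ _)
  have h4 : φ u ∣ φ s := by
    have h := Polynomial.map_dvd (Int.castRingHom (ZMod p)) h3
    rw [Polynomial.map_sub, Polynomial.map_pow, Polynomial.map_neg, Polynomial.map_mul,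
      Polynomial.map_mul, ← hφ, hφf] at h
    have h' : φ u ∣ (-(φ F * φ s)) ^ l :=
      (dvd_sub_left (dvd_mul_right _ _)).1 ((Dvd.intro (φ u * φ v) (by ring)).trans h)
    have h'' := dvd_of_squarefree_of_dvd_pow husq h'
    exact hcop.dvd_of_dvd_mul_left (dvd_neg.1 h'')
  obtain ⟨s', s'', hs⟩ := exists_eq_mul_add_of_map_dvd h4
  -- With s = us' + ps'', p y = u²v s' + p uv s'', and u²v = -pF at θ.
  have hyS : aeval θ (-(F * s') + u * v * s'') = y := by
    apply mul_left_cancel₀ hp0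
    rw [hpy, hs]
    simp only [map_add, map_mul, map_neg, aeval_C]
    simp only [eq_intCast, Int.cast_natCast]
    linear_combination -aeval θ s' * hrel
  have : x = y + aeval θ w := by rw [hy]; ring
  rw [this]
  exact S.add_mem (mem_adjoin_root_iff.2 ⟨_, hyS⟩) (mem_adjoin_root_iff.2 ⟨w, rfl⟩)

theorem minpoly_int_root (hf : f.Monic) (hirr : Irreducible (f.map (Int.castRingHom ℚ))) :
    minpoly ℤ (AdjoinRoot.root (f.map (Int.castRingHom ℚ))) = f := by
  have : Fact (Irreducible (f.map (Int.castRingHom ℚ))) := ⟨hirr⟩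
  have hθ := isIntegral_root hf
  refine eq_of_monic_of_associated (minpoly.monic hθ) hf (associated_of_dvd_dvd
    (minpoly.isIntegrallyClosed_dvd hθ ((aeval_root_eq_zero_iff hf f).2 dvd_rfl)) ?_)
  exact (aeval_root_eq_zero_iff hf _).1 (minpoly.aeval _ _)

theorem maximalAt_of_isEisensteinAt (hf : f.Monic)
    (hirr : Irreducible (f.map (Int.castRingHom ℚ))) {p : ℕ} (hp : p.Prime)
    (hE : f.IsEisensteinAt (Ideal.span {(p : ℤ)})) : MaximalAt f p := by
  intro x hx hpx
  have : Fact (Irreducible (f.map (Int.castRingHom ℚ))) := ⟨hirr⟩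
  have hgen : (AdjoinRoot.powerBasis hirr.ne_zero).gen =
    AdjoinRoot.root (f.map (Int.castRingHom ℚ)) := AdjoinRoot.powerBasis_gen _
  have := mem_adjoin_of_smul_prime_smul_of_minpoly_isEisensteinAt (R := ℤ) (K := ℚ)
    (B := AdjoinRoot.powerBasis hirr.ne_zero) (p := (p : ℤ)) (Nat.prime_iff_prime_int.1 hp)
    (by rw [hgen]; exact isIntegral_root hf) hx (by rw [hgen]; simpa using hpx)
    (by rw [hgen, minpoly_int_root hf hirr]; exact hE)
  rwa [hgen] at this

/-- Every element has a nonzero integer multiple in ℤ[θ]; the prime factors of that multiplier are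
then removed one at a time. -/
theorem isMonogenicPoly_of_maximalAt (hf : f.Monic)
    (hirr : Irreducible (f.map (Int.castRingHom ℚ))) (h : ∀ p : ℕ, p.Prime → MaximalAt f p) :
    IsMonogenicPoly f := by
  refine ⟨hf, hirr, le_antisymm (fun x hx => ?_) (adjoin_le_integralClosure (isIntegral_root hf))⟩
  have hx : IsIntegral ℤ x := hx
  have key : ∀ N : ℕ, N ≠ 0 → ∀ x : AdjoinRoot (f.map (Int.castRingHom ℚ)), IsIntegral ℤ x →
      (N : AdjoinRoot (f.map (Int.castRingHom ℚ))) * x ∈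
        Algebra.adjoin ℤ {AdjoinRoot.root (f.map (Int.castRingHom ℚ))} →
      x ∈ Algebra.adjoin ℤ {AdjoinRoot.root (f.map (Int.castRingHom ℚ))} := by
    intro N
    induction N using Nat.recOnMul with
    | zero => simp
    | one => intro _ x _ hx; simpa using hx
    | prime p hp => exact fun _ => h p hp
    | mul a b ha hb =>
      intro hab x hx hmem
      have hb' : IsIntegral ℤ ((b : AdjoinRoot (f.map (Int.castRingHom ℚ))) * x) := by
        simpa using (isIntegral_algebraMap (R := ℤ)
          (A := AdjoinRoot (f.map (Int.castRingHom ℚ))) (x := (b : ℤ))).mul hx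
      refine hb (right_ne_zero_of_mul hab) x hx (ha (left_ne_zero_of_mul hab) _ hb' ?_)
      rw [← mul_assoc]
      exact_mod_cast hmem
  obtain ⟨g, rfl⟩ := AdjoinRoot.mk_surjective x
  obtain ⟨b, hb, hbg⟩ := IsLocalization.integerNormalization_spec (nonZeroDivisors ℤ) g
  have hb0 : b ≠ 0 := nonZeroDivisors.ne_zero hb
  have hmem : (b : AdjoinRoot (f.map (Int.castRingHom ℚ))) * AdjoinRoot.mk _ g ∈
      Algebra.adjoin ℤ {AdjoinRoot.root (f.map (Int.castRingHom ℚ))} := by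
    refine mem_adjoin_root_iff.2 ⟨IsLocalization.integerNormalization (nonZeroDivisors ℤ) g, ?_⟩
    rw [← aeval_map_algebraMap ℚ, hbg, map_zsmul, AdjoinRoot.aeval_eq, zsmul_eq_mul]
  refine key b.natAbs (Int.natAbs_ne_zero.2 hb0) _ hx ?_
  rcases Int.natAbs_eq b with h | h
  · rw [h] at hmem
    simpa only [Int.cast_natCast] using hmem
  · rw [h, Int.cast_neg, neg_mul, neg_mem_iff] at hmem
    simpa only [Int.cast_natCast] using hmem

end Root

/-! ### The trinomial and its expansion in powers of x^m - c -/

theorem trinomialAA_monic {n m : ℕ} (hm : m < n) (A : ℕ) : (trinomialAA n m A).Monic := by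
  unfold trinomialAA
  rw [add_assoc]
  refine monic_X_pow_add ((degree_add_le _ _).trans_lt (max_lt ?_ ?_))
  · exact (degree_C_mul_X_pow_le _ _).trans_lt (by exact_mod_cast hm)
  · exact degree_C_le.trans_lt (by exact_mod_cast (Nat.zero_le m).trans_lt hm)

theorem trinomialAA_natDegree {n m : ℕ} (hm : m < n) (A : ℕ) :
    (trinomialAA n m A).natDegree = n := by
  unfold trinomialAA
  rw [add_assoc]
  refine natDegree_eq_of_degree_eq_some ?_
  rw [degree_add_eq_left_of_degree_lt, degree_X_pow]
  rw [degree_X_pow]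
  refine ((degree_add_le _ _).trans_lt (max_lt ?_ ?_))
  · exact (degree_C_mul_X_pow_le _ _).trans_lt (by exact_mod_cast hm)
  · exact degree_C_le.trans_lt (by exact_mod_cast (Nat.zero_le m).trans_lt hm)

/-- First order Taylor expansion of `X ^ t` with monic quadratic remainder. -/
theorem exists_X_pow_eq_sq_mul_add {R : Type*} [CommRing R] [Nontrivial R] (c : R) (k : ℕ) :
    ∃ w : R[X], w.Monic ∧ w.natDegree = k ∧
      X ^ (k + 2) = (X - C c) ^ 2 * w + C ((k + 2) * c ^ (k + 1)) * (X - C c) + C (c ^ (k + 2)) := by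
  induction k with
  | zero =>
    refine ⟨1, monic_one, natDegree_one, ?_⟩
    simp only [map_mul, map_pow, map_add, map_ofNat, Nat.cast_zero, C_0]
    ring
  | succ k ih =>
    obtain ⟨w, hw, hdeg, h⟩ := ih
    have hlt : (C ((k + 2) * c ^ (k + 1))).degree < (X * w).degree := by
      refine degree_C_le.trans_lt ?_
      rw [degree_eq_natDegree (monic_X.mul hw).ne_zero, monic_X.natDegree_mul hw, natDegree_X]
      exact_mod_cast (by omega : 0 < 1 + w.natDegree)
    refine ⟨X * w + C ((k + 2) * c ^ (k + 1)), (monic_X.mul hw).add_of_left hlt, ?_, ?_⟩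
    · rw [natDegree_eq_of_degree_eq (degree_add_eq_left_of_degree_lt hlt), monic_X.natDegree_mul hw,
        natDegree_X, hdeg, add_comm]
    · rw [show k + 1 + 2 = k + 2 + 1 by ring, pow_succ X, h]
      simp only [map_mul, map_pow, map_add, map_natCast, map_ofNat, Nat.cast_add, Nat.cast_one,
        map_one]
      ring

/-- Taylor expansion of g(y) = y^t + Ay + A at c, evaluated at y = x^m; the lower coefficients are
g'(c) and g(c). -/
theorem trinomialAA_eq_sq_mul_add {m t : ℕ} (hm : m ≠ 0) (ht : 2 ≤ t) (A : ℕ) (c : ℤ) :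
    ∃ v : ℤ[X], v.Monic ∧ v.natDegree = (t - 2) * m ∧
      trinomialAA (m * t) m A = (X ^ m - C c) ^ 2 * v +
        (C (t * c ^ (t - 1) + A) * (X ^ m - C c) + C (c ^ t + A * c + A)) := by
  obtain ⟨k, rfl⟩ := Nat.exists_eq_add_of_le' ht
  obtain ⟨w, hw, hdeg, h⟩ := exists_X_pow_eq_sq_mul_add c k
  refine ⟨expand ℤ m w, hw.expand (Nat.pos_of_ne_zero hm), ?_, ?_⟩
  · rw [natDegree_expand, hdeg, Nat.add_sub_cancel]
  · have h' := congrArg (expand ℤ m) h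
    simp only [map_pow, map_mul, map_add, map_sub, expand_X, expand_C] at h'
    unfold trinomialAA
    rw [pow_mul, h', show k + 2 - 1 = k + 1 by omega]
    simp only [map_mul, map_pow, map_add, map_natCast, map_ofNat, Nat.cast_add, Nat.cast_ofNat]
    ring

/-! ### Congruences at the critical point c = t/(1-t) -/

section Congruence

variable {t : ℕ} {A c d : ℤ}

/-- Substitute (1-t)c ≡ t. The right side is D, the factor of disc(g) left after A^(t-1), up to
sign. -/
theorem one_sub_pow_mul_eval_modEq (ht : 2 ≤ t) (hc : d ∣ (1 - t) * c - t) :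
    (1 - (t : ℤ)) ^ t * (c ^ t + A * c + A) ≡ t ^ t + (1 - t) ^ (t - 1) * A [ZMOD d] := by
  have h1 : (1 - (t : ℤ)) * c ≡ t [ZMOD d] := (Int.modEq_iff_dvd.2 hc).symm
  obtain ⟨k, rfl⟩ : ∃ k, t = k + 1 := ⟨t - 1, by omega⟩
  rw [Nat.add_sub_cancel]
  calc (1 - ((k + 1 : ℕ) : ℤ)) ^ (k + 1) * (c ^ (k + 1) + A * c + A)
      = ((1 - ((k + 1 : ℕ) : ℤ)) * c) ^ (k + 1) + A * (1 - ((k + 1 : ℕ) : ℤ)) ^ k *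
        ((1 - ((k + 1 : ℕ) : ℤ)) * c + (1 - ((k + 1 : ℕ) : ℤ))) := by
        rw [mul_pow]; ring
    _ ≡ ((k + 1 : ℕ) : ℤ) ^ (k + 1) + A * (1 - ((k + 1 : ℕ) : ℤ)) ^ k *
        (((k + 1 : ℕ) : ℤ) + (1 - ((k + 1 : ℕ) : ℤ))) [ZMOD d] :=
        (h1.pow _).add ((h1.add_right _).mul_left _)
    _ = _ := by ring

/-- From y g'(y) = t g(y) + A((1-t)y - t), which also explains the choice of c. -/
theorem dvd_mul_deriv_of_dvd_eval (ht : 2 ≤ t) (hc : d ∣ (1 - t) * c - t)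
    (h : d ∣ c ^ t + A * c + A) : d ∣ c * (t * c ^ (t - 1) + A) := by
  have : c * (t * c ^ (t - 1) + A) = t * (c ^ t + A * c + A) + A * ((1 - t) * c - t) := by
    obtain ⟨k, rfl⟩ : ∃ k, t = k + 1 := ⟨t - 1, by omega⟩
    rw [Nat.add_sub_cancel]
    ring
  rw [this]
  exact dvd_add (h.mul_left _) (hc.mul_left _)

theorem exists_dvd_mul_sub (h : IsCoprime (1 - (t : ℤ)) d) :
    ∃ c : ℤ, d ∣ (1 - t) * c - t := by
  obtain ⟨a, b, hab⟩ := h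
  exact ⟨a * t, -(b * t), by linear_combination -(t : ℤ) * hab + 2 * (t : ℤ) * hab⟩

end Congruence

/-! ### Obstructions to monogenicity -/

/-- Here θ^(n-1)/p is integral, since θ^(2n-2) = -A θ^(n-2) (θ^m + 1). -/
theorem not_isMonogenicPoly_of_sq_dvd {n m A p : ℕ} (hn : 2 ≤ n) (hm : m < n) (hp : p.Prime)
    (h : p ^ 2 ∣ A) : ¬ IsMonogenicPoly (trinomialAA n m A) := by
  obtain ⟨B, rfl⟩ := h
  refine not_isMonogenicPoly_of_sq_eq hp (g := X ^ (n - 1)) (s := X ^ (n - 2))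
    (r := -(X ^ (n - 2) * (C (B : ℤ) * X ^ m + C (B : ℤ)))) (monic_X_pow _) ?_ ?_
  · rw [natDegree_X_pow, trinomialAA_natDegree hm]
    omega
  · obtain ⟨k, rfl⟩ := Nat.exists_eq_add_of_le' hn
    rw [show k + 2 - 1 = k + 1 by omega, Nat.add_sub_cancel, trinomialAA]
    simp only [Nat.cast_mul, Nat.cast_pow, map_mul, map_pow]
    ring

/-- Choosing c modulo p², not just modulo p, makes both g(c) and g'(c) vanish modulo p². Then f ≡
u²v mod p² with u = x^m - c, and u(θ)v(θ)/p is integral. -/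
theorem not_isMonogenicPoly_of_sq_dvd_discr {m t A p : ℕ} (hm : m ≠ 0) (ht : 2 ≤ t)
    (hp : p.Prime) (hpt : ¬ p ∣ t) (hpt' : ¬ (p : ℤ) ∣ 1 - t)
    (h : (p : ℤ) ^ 2 ∣ t ^ t + (1 - t) ^ (t - 1) * A) :
    ¬ IsMonogenicPoly (trinomialAA (m * t) m A) := by
  have hpz := Nat.prime_iff_prime_int.1 hp
  have hcop : IsCoprime (1 - (t : ℤ)) ((p : ℤ) ^ 2) :=
    ((hpz.coprime_iff_not_dvd).2 hpt').symm.pow_right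
  obtain ⟨c, hc⟩ := exists_dvd_mul_sub hcop
  have hH : (p : ℤ) ^ 2 ∣ c ^ t + A * c + A := by
    have h1 := one_sub_pow_mul_eval_modEq (A := A) ht hc
    exact hcop.symm.pow_right.dvd_of_dvd_mul_left ((h1.dvd_iff).2 h)
  have hpc : ¬ (p : ℤ) ∣ c := fun hpc => hpt <| by
    have := (dvd_sub_right (hpc.mul_left (1 - (t : ℤ)))).1 ((dvd_pow_self _ two_ne_zero).trans hc)
    exact_mod_cast this
  have hH' : (p : ℤ) ^ 2 ∣ t * c ^ (t - 1) + A :=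
    ((hpz.coprime_iff_not_dvd).2 hpc).pow_left.dvd_of_dvd_mul_left
      (dvd_mul_deriv_of_dvd_eval ht hc hH)
  obtain ⟨v, hv, hdeg, hf⟩ := trinomialAA_eq_sq_mul_add hm ht A c
  obtain ⟨a, ha⟩ := hH
  obtain ⟨b, hb⟩ := hH'
  have hu : (X ^ m - C c : ℤ[X]).Monic := monic_X_pow_sub_C c hm
  have hlt : m < m * t := by nlinarith [Nat.pos_of_ne_zero hm]
  refine not_isMonogenicPoly_of_sq_eq hp (g := (X ^ m - C c) * v) (s := v)
    (r := -((C b * (X ^ m - C c) + C a) * v)) (hu.mul hv) ?_ ?_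
  · rw [hu.natDegree_mul hv, natDegree_X_pow_sub_C, hdeg, trinomialAA_natDegree hlt]
    obtain ⟨k, rfl⟩ := Nat.exists_eq_add_of_le' ht
    rw [Nat.add_sub_cancel]
    nlinarith [Nat.pos_of_ne_zero hm]
  · rw [hf, ha, hb]
    simp only [map_mul, map_pow, map_natCast]
    ring

/-! ### Separability over a field -/

theorem isCoprime_of_mul_add_mul_eq_C {k : Type*} [Field k] {x y a b : k[X]} {r : k} (hr : r ≠ 0)
    (h : a * x + b * y = C r) : IsCoprime x y :=
  ⟨C r⁻¹ * a, C r⁻¹ * b, by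
    rw [mul_assoc, mul_assoc, ← mul_add, h, ← C_mul, inv_mul_cancel₀ hr, C_1]⟩

section Separable

variable {k : Type*} [Field k] {m t : ℕ} {A c : k}

/-- Writing f = u²v, the combination x f' - mt f equals mA(1-t)u. Cancelling one u exhibits a
nonzero constant both in (u, v) and in (v, v'); u itself is separable because mc ≠ 0. -/
theorem separable_mul_of_eq_sq_mul (hm : (m : k) ≠ 0) (hA : A ≠ 0) (ht : (1 - t : k) ≠ 0)
    (hc0 : c ≠ 0) (hc : (1 - t) * c = t) {v : k[X]}
    (h : X ^ (m * t) + C A * X ^ m + C A = (X ^ m - C c) ^ 2 * v) :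
    ((X ^ m - C c) * v).Separable := by
  have hm0 : m ≠ 0 := fun h => hm (by simp [h])
  set u : k[X] := X ^ m - C c with hu
  have hu0 : u ≠ 0 := (monic_X_pow_sub_C c hm0).ne_zero
  have hXpow : ∀ j : ℕ, X * derivative (X ^ j : k[X]) = C (j : k) * X ^ j := by
    intro j
    rcases j with _ | j
    · simp
    · simp; ring
  have hXu : X * derivative u = C (m : k) * (u + C c) := by
    rw [hu, derivative_sub, derivative_C, sub_zero, hXpow]
    ring
  have key : C (m * A * (1 - t)) =
      2 * (X * derivative u) * v + u * (X * derivative v) - C ((m * t : ℕ) : k) * u * v := by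
    apply mul_left_cancel₀ hu0
    have h1 := congrArg (fun q => X * derivative q - C ((m * t : ℕ) : k) * q) h
    simp only [derivative_add, derivative_mul, derivative_C, derivative_pow u,
      zero_mul, zero_add, add_zero, mul_add, hXpow] at h1
    have h2 : X * (C A * derivative (X ^ m : k[X])) = C A * (C (m : k) * X ^ m) := by
      rw [← hXpow]; ring
    rw [h2] at h1
    have h3 : C ((m * t : ℕ) : k) = C (m : k) * C (t : k) := by rw [Nat.cast_mul, C_mul]
    have h4 : (1 - C (t : k)) * C c = C (t : k) := by
      rw [← C_1, ← C_sub, ← C_mul, hc]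
    have h5 : (X ^ m : k[X]) = u + C c := by rw [hu]; ring
    rw [h5, h3] at h1
    rw [h3]
    simp only [map_mul, map_sub, map_one]
    simp only [Nat.cast_ofNat, Nat.add_one_sub_one, pow_one] at h1
    have h6 : (C 2 : k[X]) = 2 := rfl
    rw [h6] at h1
    linear_combination h1 - C (m : k) * C A * h4
  have hr : m * A * (1 - t) ≠ 0 := mul_ne_zero (mul_ne_zero hm hA) ht
  have hus : u.Separable := by
    refine isCoprime_of_mul_add_mul_eq_C (mul_ne_zero hm hc0) (a := -C (m : k)) (b := X) ?_
    rw [hXu, C_mul]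
    ring
  have hvs : v.Separable := by
    refine isCoprime_of_mul_add_mul_eq_C hr
      (a := 2 * (X * derivative u) - C ((m * t : ℕ) : k) * u) (b := u * X) ?_
    rw [key]
    ring
  have huv : IsCoprime u v := by
    refine isCoprime_of_mul_add_mul_eq_C hr (a := X * derivative v - C ((m * t : ℕ) : k) * v)
      (b := 2 * (X * derivative u)) ?_
    rw [key]
    ring
  exact hus.mul hvs huv

/-- This combination of f and f' removes the leading term, leaving a binomial in x^m whose root is
c. -/
theorem X_mul_derivative_trinomial :
    X * derivative (X ^ (m * t) + C A * X ^ m + C A) -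
      C ((m * t : ℕ) : k) * (X ^ (m * t) + C A * X ^ m + C A) =
      C (m * A) * (C (1 - t : k) * X ^ m - C (t : k)) := by
  have hXpow : ∀ j : ℕ, X * derivative (X ^ j : k[X]) = C (j : k) * X ^ j := by
    intro j
    rcases j with _ | j
    · simp
    · simp; ring
  have h2 : X * (C A * derivative (X ^ m : k[X])) = C A * (C (m : k) * X ^ m) := by
    rw [← hXpow]; ring
  simp only [derivative_add, derivative_mul, derivative_C, zero_mul, zero_add, add_zero, mul_add,
    hXpow, h2, Nat.cast_mul, map_mul, map_sub, map_one]
  ring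

/-- When t = 1 in k, the binomial above degenerates to the nonzero constant -mA. -/
theorem separable_trinomial_of_one_sub_eq_zero (hm : (m : k) ≠ 0) (hA : A ≠ 0)
    (ht : (1 - t : k) = 0) : (X ^ (m * t) + C A * X ^ m + C A).Separable := by
  have ht' : (t : k) = 1 := (sub_eq_zero.1 ht).symm
  refine isCoprime_of_mul_add_mul_eq_C (mul_ne_zero hm hA) (a := C ((m * t : ℕ) : k)) (b := -X) ?_
  have := X_mul_derivative_trinomial (m := m) (t := t) (A := A)
  rw [ht, ht'] at this
  simp only [C_0, C_1] at this
  linear_combination -this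

/-- The ideal (f, f') contains mA(1-t)(x^m - c), and f is the nonzero constant r modulo x^m - c. -/
theorem separable_trinomial_of_eval_ne_zero (hm : (m : k) ≠ 0) (hA : A ≠ 0)
    (ht : (1 - t : k) ≠ 0) (hc : (1 - t) * c = t) {q : k[X]} {r : k} (hr : r ≠ 0)
    (h : X ^ (m * t) + C A * X ^ m + C A = (X ^ m - C c) * q + C r) :
    (X ^ (m * t) + C A * X ^ m + C A).Separable := by
  have key := X_mul_derivative_trinomial (m := m) (t := t) (A := A)
  refine isCoprime_of_mul_add_mul_eq_C (mul_ne_zero (mul_ne_zero (mul_ne_zero hm hA) ht) hr)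
    (a := C (m * A * (1 - t)) + q * C ((m * t : ℕ) : k)) (b := -(q * X)) ?_
  have h4 : (1 - C (t : k)) * C c = C (t : k) := by
    rw [← C_1, ← C_sub, ← C_mul, hc]
  simp only [map_mul, map_sub, map_one] at key ⊢
  linear_combination -q * key + C (m : k) * C A * (1 - C (t : k)) * h - C (m : k) * C A * q * h4

end Separable

/-! ### Local maximality and the criterion for monogenicity -/

theorem map_trinomialAA {R : Type*} [CommRing R] (n m A : ℕ) :
    (trinomialAA n m A).map (Int.castRingHom R) =
      X ^ n + C (A : R) * X ^ m + C (A : R) := by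
  simp [trinomialAA]

theorem maximalAt_trinomialAA {m t A p : ℕ} (hm : m ≠ 0) (ht : 2 ≤ t)
    (hirr : Irreducible ((trinomialAA (m * t) m A).map (Int.castRingHom ℚ)))
    (hp : p.Prime) (hpm : ¬ p ∣ m) (hpA : ¬ p ∣ A)
    (h : ¬ (p : ℤ) ∣ 1 - t → ¬ (p : ℤ) ^ 2 ∣ t ^ t + (1 - t) ^ (t - 1) * A) :
    MaximalAt (trinomialAA (m * t) m A) p := by
  have : Fact p.Prime := ⟨hp⟩
  have hpz := Nat.prime_iff_prime_int.1 hp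
  have hmonic : (trinomialAA (m * t) m A).Monic :=
    trinomialAA_monic (by nlinarith [Nat.pos_of_ne_zero hm]) A
  have hm' : (m : ZMod p) ≠ 0 := by rwa [Ne, ZMod.natCast_eq_zero_iff]
  have hA' : (A : ZMod p) ≠ 0 := by rwa [Ne, ZMod.natCast_eq_zero_iff]
  have hcast : ∀ z : ℤ, (z : ZMod p) = 0 ↔ (p : ℤ) ∣ z := fun z =>
    ZMod.intCast_zmod_eq_zero_iff_dvd z p
  -- A separable reduction is the case u = 1, F = 0 of Dedekind's criterion.
  have hsep : ((trinomialAA (m * t) m A).map (Int.castRingHom (ZMod p))).Separable →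
      MaximalAt (trinomialAA (m * t) m A) p := fun hs =>
    maximalAt_of_eq_sq_mul_add hmonic hirr hp (u := 1) (v := trinomialAA (m * t) m A) (F := 0)
      (by simp) (by rw [one_mul]; exact hs.squarefree)
      (by rw [Polynomial.map_one]; exact isCoprime_one_left)
  by_cases hpt : (p : ℤ) ∣ 1 - t
  · apply hsep
    rw [map_trinomialAA]
    exact separable_trinomial_of_one_sub_eq_zero hm' hA' (by simpa using (hcast _).2 hpt)
  have hD := h hpt
  have hcop' := ((hpz.coprime_iff_not_dvd).2 hpt)
  have hcop : IsCoprime (1 - (t : ℤ)) ((p : ℤ) ^ 2) := hcop'.symm.pow_right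
  have ht' : (1 - t : ZMod p) ≠ 0 := by
    have := (hcast (1 - t)).not.2 hpt
    simpa using this
  obtain ⟨c, hc⟩ := exists_dvd_mul_sub hcop
  have hc1 : (p : ℤ) ∣ (1 - t) * c - t := (dvd_pow_self _ two_ne_zero).trans hc
  have hc' : (1 - t) * (c : ZMod p) = t := by
    have := (hcast _).2 hc1
    push_cast at this
    exact sub_eq_zero.1 this
  have hmod2 := one_sub_pow_mul_eval_modEq (A := A) ht hc
  have hmod1 := one_sub_pow_mul_eval_modEq (A := A) ht hc1
  obtain ⟨v, hv, -, hf⟩ := trinomialAA_eq_sq_mul_add hm ht A c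
  -- If p ∣ g(c), then also p ∣ g'(c), so f = u²v + p(bu + a) with a = g(c)/p. As p² ∤ D, a is a
  -- unit modulo p, hence bu + a is coprime to u. If p ∤ g(c), the reduction is separable.
  by_cases hH : (p : ℤ) ∣ c ^ t + A * c + A
  · have hpc : ¬ (p : ℤ) ∣ c := by
      intro hpc
      have hdt : (p : ℤ) ∣ t := (dvd_sub_right (hpc.mul_left (1 - (t : ℤ)))).1 hc1
      have h1 := (hmod1.dvd_iff).1 (hH.mul_left _)
      have h2 := (dvd_add_right (hdt.trans (dvd_pow_self _ (by omega)))).1 h1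
      exact hpA (by exact_mod_cast hcop'.pow_right.dvd_of_dvd_mul_left h2)
    have hH' : (p : ℤ) ∣ t * c ^ (t - 1) + A :=
      ((hpz.coprime_iff_not_dvd).2 hpc).dvd_of_dvd_mul_left (dvd_mul_deriv_of_dvd_eval ht hc1 hH)
    obtain ⟨a, ha⟩ := hH
    obtain ⟨b, hb⟩ := hH'
    have hpa : ¬ (p : ℤ) ∣ a := by
      rintro ⟨a', rfl⟩
      refine hD ((hmod2.dvd_iff).1 (Dvd.dvd.mul_left ⟨a', ?_⟩ _))
      rw [ha, sq, mul_assoc]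
    rw [ha, hb] at hf
    refine maximalAt_of_eq_sq_mul_add hmonic hirr hp (u := X ^ m - C c) (v := v)
      (F := C b * (X ^ m - C c) + C a) ?_ ?_ ?_
    · rw [hf]
      simp only [map_mul]
      ring
    · have hfp := congrArg (Polynomial.map (Int.castRingHom (ZMod p))) hf
      rw [map_trinomialAA] at hfp
      simp only [Polynomial.map_add, Polynomial.map_mul, Polynomial.map_pow, Polynomial.map_sub,
        Polynomial.map_X, Polynomial.map_C, map_mul, Int.coe_castRingHom, Int.cast_natCast,
        CharP.cast_eq_zero, zero_mul, C_0, add_zero] at hfp ⊢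
      exact (separable_mul_of_eq_sq_mul hm' hA' ht' ((hcast c).not.2 hpc) hc' hfp).squarefree
    · refine isCoprime_of_mul_add_mul_eq_C ((hcast a).not.2 hpa) (a := -C (b : ZMod p)) (b := 1) ?_
      simp
  · apply hsep
    have hfp := congrArg (Polynomial.map (Int.castRingHom (ZMod p))) hf
    rw [map_trinomialAA] at hfp ⊢
    rw [Polynomial.map_add, Polynomial.map_add, Polynomial.map_C] at hfp
    refine separable_trinomial_of_eval_ne_zero (c := c) hm' hA' ht' hc' ((hcast _).not.2 hH)
      (q := (X ^ m - C (c : ZMod p)) * v.map (Int.castRingHom (ZMod p)) +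
        C ((t * c ^ (t - 1) + A : ℤ) : ZMod p)) ?_
    rw [hfp]
    simp only [Polynomial.map_mul, Polynomial.map_pow, Polynomial.map_sub,
        Polynomial.map_X, Polynomial.map_C, Int.coe_castRingHom]
    ring

theorem trinomialAA_isEisensteinAt {n m A p : ℕ} (hm : m < n) (hm0 : m ≠ 0) (hp : p.Prime)
    (hA : p ∣ A) (hA2 : ¬ p ^ 2 ∣ A) :
    (trinomialAA n m A).IsEisensteinAt (Ideal.span {(p : ℤ)}) := by
  have hpz := Nat.prime_iff_prime_int.1 hp
  have hA' : (p : ℤ) ∣ A := by exact_mod_cast hA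
  refine (trinomialAA_monic hm A).isEisensteinAt_of_mem_of_notMem
    ((Ideal.span_singleton_prime hpz.ne_zero).2 hpz).ne_top (fun {i} hi => ?_) ?_
  · rw [trinomialAA_natDegree hm] at hi
    rw [Ideal.mem_span_singleton, trinomialAA, coeff_add, coeff_add, coeff_X_pow, if_neg hi.ne,
      zero_add, coeff_C_mul, coeff_C]
    refine dvd_add (hA'.mul_right _) ?_
    split_ifs
    · exact hA'
    · exact dvd_zero _
  · rw [Ideal.span_singleton_pow, Ideal.mem_span_singleton, trinomialAA, coeff_add, coeff_add,
      coeff_X_pow, if_neg (by omega), zero_add, coeff_C_mul, coeff_X_pow, if_neg hm0.symm, mul_zero,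
      zero_add, coeff_C_zero]
    exact_mod_cast hA2

theorem squarefreeKernel_dvd_iff_of_prime {p m : ℕ} (hp : p.Prime) (hm : m ≠ 0) :
    p ∣ squarefreeKernel m ↔ p ∣ m := by
  unfold squarefreeKernel
  exact UniqueFactorizationMonoid.dvd_radical_iff_of_irreducible hp.prime.irreducible hm

theorem squarefree_of_isMonogenicPoly_trinomialAA {n m A : ℕ} (hn : 2 ≤ n) (hm : m < n)
    (h : IsMonogenicPoly (trinomialAA n m A)) : Squarefree A := by
  rw [Nat.squarefree_iff_prime_squarefree]
  intro p hp hpA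
  exact not_isMonogenicPoly_of_sq_dvd hn hm hp (by rwa [sq]) h

theorem not_sq_dvd_of_isMonogenicPoly_trinomialAA {m t A : ℕ} (hm : m ≠ 0) (ht : 2 ≤ t)
    (h : IsMonogenicPoly (trinomialAA (m * t) m A)) {p : ℕ} (hp : p.Prime)
    (hpt : ¬ p ∣ t * (t - 1) * squarefreeKernel m) :
    ¬ (p : ℤ) ^ 2 ∣ t ^ t + (1 - t) ^ (t - 1) * A := by
  intro hD
  refine not_isMonogenicPoly_of_sq_dvd_discr hm ht hp
    (fun hd => hpt ((hd.mul_right _).mul_right _)) (fun hd => hpt ?_) hD h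
  refine Dvd.dvd.mul_right (Dvd.dvd.mul_left ?_ _) _
  rw [← Int.natCast_dvd_natCast, Nat.cast_sub (by omega)]
  exact (dvd_sub_comm).1 (by simpa using hd)

/-- A ≥ 2 supplies a prime factor of A at which f is Eisenstein, hence irreducible. A prime not
dividing A does not divide m, because κ ∣ A. -/
theorem isMonogenicPoly_trinomialAA {m t A : ℕ} (hm : m ≠ 0) (ht : 2 ≤ t)
    (hA : 2 ≤ A) (hκ : squarefreeKernel m ∣ A) (hsq : Squarefree A)
    (h : ∀ p : ℕ, p.Prime → ¬ p ∣ t * (t - 1) * squarefreeKernel m →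
      ¬ (p : ℤ) ^ 2 ∣ t ^ t + (1 - t) ^ (t - 1) * A) :
    IsMonogenicPoly (trinomialAA (m * t) m A) := by
  have hlt : m < m * t := by nlinarith [Nat.pos_of_ne_zero hm]
  have hmonic := trinomialAA_monic hlt A
  have hE : ∀ p : ℕ, p.Prime → p ∣ A →
      (trinomialAA (m * t) m A).IsEisensteinAt (Ideal.span {(p : ℤ)}) := fun p hp hpA =>
    trinomialAA_isEisensteinAt hlt hm hp hpA fun h2 =>
      Nat.squarefree_iff_prime_squarefree.1 hsq p hp (by rwa [← sq])
  have hirr : Irreducible ((trinomialAA (m * t) m A).map (Int.castRingHom ℚ)) := by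
    obtain ⟨p, hp, hpA⟩ := Nat.exists_prime_and_dvd (by omega : A ≠ 1)
    have hpz := Nat.prime_iff_prime_int.1 hp
    refine (hmonic.irreducible_iff_irreducible_map_fraction_map (K := ℚ)).1
      ((hE p hp hpA).irreducible ((Ideal.span_singleton_prime hpz.ne_zero).2 hpz)
        hmonic.isPrimitive ?_)
    rw [trinomialAA_natDegree hlt]
    omega
  refine isMonogenicPoly_of_maximalAt hmonic hirr fun p hp => ?_
  by_cases hpA : p ∣ A
  · exact maximalAt_of_isEisensteinAt hmonic hirr hp (hE p hp hpA)
  have hpκ : ¬ p ∣ squarefreeKernel m := fun hd => hpA (hd.trans hκ)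
  have hpm : ¬ p ∣ m := fun hd => hpκ ((squarefreeKernel_dvd_iff_of_prime hp hm).2 hd)
  refine maximalAt_trinomialAA hm ht hirr hp hpm hpA fun hpt hD => ?_
  have hpz := Nat.prime_iff_prime_int.1 hp
  -- For p ∣ t, D ≡ (1-t)^(t-1) A is a unit modulo p, so D has no factor p², let alone an
  -- obstruction.
  by_cases hdt : p ∣ t
  · have hdt' : (p : ℤ) ∣ t ^ t :=
      (Int.natCast_dvd_natCast.2 hdt).trans (dvd_pow_self _ (by omega))
    have h2 := (dvd_add_right hdt').1 ((dvd_pow_self _ two_ne_zero).trans hD)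
    exact hpA (by exact_mod_cast
      ((hpz.coprime_iff_not_dvd).2 hpt).pow_right.dvd_of_dvd_mul_left h2)
  · refine h p hp ?_ hD
    rw [hp.dvd_mul, hp.dvd_mul]
    rintro ((hd | hd) | hd)
    · exact hdt hd
    · rw [← Int.natCast_dvd_natCast, Nat.cast_sub (by omega)] at hd
      exact hpt ((dvd_sub_comm).1 (by simpa using hd))
    · exact hpκ hd

/-! ### The discriminant -/

/-- Since x f' = Ag + nf, Res(f, x f') = A^n Res(f, g). The same resultant is Res(f, f') Res(f, x) =
± disc(f) · A; cancel one A. -/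
theorem pow_dvd_discr_trinomialAA {n m A : ℕ} (hm0 : m ≠ 0) (hm : m < n) (hA : A ≠ 0) :
    (A : ℤ) ^ (n - 1) ∣ (trinomialAA n m A).discr := by
  set f := trinomialAA n m A with hf
  have hdeg : f.natDegree = n := trinomialAA_natDegree hm A
  have hmonic : f.Monic := trinomialAA_monic hm A
  set g : ℤ[X] := -(C ((n : ℤ) - m) * X ^ m + C (n : ℤ)) with hg
  have hXpow : ∀ j : ℕ, derivative (X ^ j : ℤ[X]) * X = C (j : ℤ) * X ^ j := by
    intro j
    rcases j with _ | j
    · simp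
    · simp; ring
  have hrel : derivative f * X = C (A : ℤ) * g + f * C (n : ℤ) := by
    have h2 : C (A : ℤ) * derivative (X ^ m : ℤ[X]) * X = C (A : ℤ) * (C (m : ℤ) * X ^ m) := by
      rw [← hXpow]; ring
    rw [hf, hg, trinomialAA]
    simp only [derivative_add, derivative_mul, derivative_C, zero_mul, zero_add, add_zero, add_mul,
      hXpow, h2, map_sub]
    ring
  have hdeg' : (derivative f).natDegree = n - 1 := by
    rw [natDegree_derivative, hdeg]
  -- The second formal degree is n = (n-1) + 1 although g has degree at most m, so that
  -- multiplicativity applies to f' · x.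
  have h1 : f.resultant (derivative f * X) n n = (A : ℤ) ^ n * f.resultant g n n := by
    rw [hrel, resultant_add_mul_right _ _ _ _ _ (by simp) hdeg.le, resultant_C_mul_right]
  have h2 := resultant_mul_right f (derivative f) X n hdeg.le
  rw [hdeg', natDegree_X, Nat.sub_add_cancel (by omega), h1] at h2
  have h3 := resultant_deriv (f := f) (natDegree_pos_iff_degree_pos.1 (by omega))
  have h4 : f.resultant X n 1 = (-1) ^ n * A := by
    have h := resultant_X_sub_C_right f n (0 : ℤ) hdeg.le
    rw [C_0, sub_zero] at h
    rw [h, hf, trinomialAA]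
    have hn0 : n ≠ 0 := by omega
    simp [hm0, hn0]
  rw [hdeg, hmonic.leadingCoeff, mul_one] at h3
  rw [h3, h4] at h2
  have hA' : (A : ℤ) ≠ 0 := by exact_mod_cast hA
  have h5 : (A : ℤ) ^ (n - 1) * f.resultant g n n =
      (-1) ^ (n * (n - 1) / 2) * (-1) ^ n * f.discr := by
    apply mul_left_cancel₀ hA'
    rw [← mul_assoc, ← pow_succ', Nat.sub_add_cancel (by omega), h2]
    ring
  have h6 : IsUnit ((-1 : ℤ) ^ (n * (n - 1) / 2) * (-1) ^ n) :=
    (isUnit_one.neg.pow _).mul (isUnit_one.neg.pow _)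
  exact h6.dvd_mul_left.1 ⟨_, h5.symm⟩

theorem not_squarefree_discr_trinomialAA {n m A : ℕ} (hm0 : m ≠ 0) (hm : m < n) (hn : 3 ≤ n)
    (hA : 2 ≤ A) : ¬ Squarefree (trinomialAA n m A).discr := by
  intro h
  have h1 : (A : ℤ) * A ∣ (trinomialAA n m A).discr := by
    rw [← sq]
    exact (pow_dvd_pow _ (by omega)).trans (pow_dvd_discr_trinomialAA hm0 hm (by omega))
  have := Int.isUnit_iff.1 (h _ h1)
  omega

/-! ### Möbius detection of square divisors -/

/-- The Möbius function restricted to the integers coprime to `T`. -/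
noncomputable def coprimeMoebius (T e : ℕ) : ℝ :=
  if e.Coprime T then (ArithmeticFunction.moebius e : ℝ) else 0

theorem abs_coprimeMoebius_le_one (T e : ℕ) : |coprimeMoebius T e| ≤ 1 := by
  unfold coprimeMoebius
  split_ifs
  · exact_mod_cast ArithmeticFunction.abs_moebius_le_one
  · simp

theorem coprime_and_squarefree_of_coprimeMoebius_ne_zero {T e : ℕ} (h : coprimeMoebius T e ≠ 0) :
    e.Coprime T ∧ Squarefree e := by
  unfold coprimeMoebius at h
  split_ifs at h with hc
  · exact ⟨hc, ArithmeticFunction.moebius_ne_zero_iff_squarefree.1 (by exact_mod_cast h)⟩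
  · exact absurd rfl h

open Classical in
/-- Detecting square divisors coprime to `T` by Möbius inversion. -/
theorem sum_coprimeMoebius_filter {T n E : ℕ} (hn : n ≠ 0) (hE : n ≤ E ^ 2) :
    ∑ e ∈ (Finset.Ioc 0 E).filter (fun e => e ^ 2 ∣ n), coprimeMoebius T e =
      if ∀ p : ℕ, p.Prime → ¬ p ∣ T → ¬ p ^ 2 ∣ n then 1 else 0 := by
  set P := n.primeFactors.filter (fun p => ¬ p ∣ T ∧ p ^ 2 ∣ n) with hP
  have hPp : ∀ p ∈ P, p.Prime := fun p hp => (Nat.mem_primeFactors.1 (Finset.mem_filter.1 hp).1).1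
  -- The squarefree e prime to T with e² ∣ n are exactly the divisors of R, so the sum is ∑ μ(e)
  -- over e ∣ R. The bound n ≤ E² guarantees that none is cut off.
  set R := ∏ p ∈ P, p with hR
  have hcop : (P : Set ℕ).Pairwise (Function.onFun IsRelPrime fun p : ℕ => p ^ 2) := by
    intro p hp q hq hpq
    exact Nat.coprime_iff_isRelPrime.1
      (((Nat.coprime_primes (hPp p hp) (hPp q hq)).2 hpq).pow 2 2)
  have hR2 : R ^ 2 ∣ n := by
    rw [hR, ← Finset.prod_pow]
    exact Finset.prod_dvd_of_isRelPrime hcop fun p hp => (Finset.mem_filter.1 hp).2.2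
  have hR0 : R ≠ 0 := fun h => hn (by rw [h] at hR2; simpa using hR2)
  have hRT : R.Coprime T := Nat.Coprime.prod_left fun p hp =>
    ((hPp p hp).coprime_iff_not_dvd).2 (Finset.mem_filter.1 hp).2.1
  have h1 : ∑ e ∈ R.divisors, coprimeMoebius T e =
      ∑ e ∈ (Finset.Ioc 0 E).filter (fun e => e ^ 2 ∣ n), coprimeMoebius T e := by
    refine Finset.sum_subset (fun e he => ?_) (fun e he heR => ?_)
    · have hdvd := Nat.dvd_of_mem_divisors he
      have h2 : e ^ 2 ∣ n := (pow_dvd_pow_of_dvd hdvd 2).trans hR2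
      refine Finset.mem_filter.2 ⟨Finset.mem_Ioc.2 ⟨Nat.pos_of_dvd_of_pos hdvd
        (Nat.pos_of_ne_zero hR0), ?_⟩, h2⟩
      exact (Nat.pow_le_pow_iff_left two_ne_zero).1
        ((Nat.le_of_dvd (Nat.pos_of_ne_zero hn) h2).trans hE)
    · by_contra hne
      obtain ⟨hc, hsq⟩ := coprime_and_squarefree_of_coprimeMoebius_ne_zero hne
      refine heR (Nat.mem_divisors.2 ⟨?_, hR0⟩)
      rw [← Nat.prod_primeFactors_of_squarefree hsq]
      refine Finset.prod_dvd_prod_of_subset _ _ _ fun p hp => ?_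
      have hpp := Nat.prime_of_mem_primeFactors hp
      have hpe := Nat.dvd_of_mem_primeFactors hp
      have hp2 : p ^ 2 ∣ n := (pow_dvd_pow_of_dvd hpe 2).trans (Finset.mem_filter.1 he).2
      exact Finset.mem_filter.2 ⟨Nat.mem_primeFactors.2
        ⟨hpp, (dvd_pow_self p two_ne_zero).trans hp2, hn⟩,
        (hpp.coprime_iff_not_dvd).1 (Nat.Coprime.coprime_dvd_left hpe hc), hp2⟩
  have h2 : ∑ e ∈ R.divisors, coprimeMoebius T e =
      ((∑ e ∈ R.divisors, ArithmeticFunction.moebius e : ℤ) : ℝ) := by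
    rw [Int.cast_sum]
    refine Finset.sum_congr rfl fun e he => ?_
    rw [coprimeMoebius, if_pos (Nat.Coprime.coprime_dvd_left (Nat.dvd_of_mem_divisors he) hRT)]
  rw [← h1, h2, ← ArithmeticFunction.coe_mul_zeta_apply, ArithmeticFunction.moebius_mul_coe_zeta,
    ArithmeticFunction.one_apply]
  have h3 : R = 1 ↔ ∀ p : ℕ, p.Prime → ¬ p ∣ T → ¬ p ^ 2 ∣ n := by
    constructor
    · intro h p hp hpT hpn
      have hpP : p ∈ P := Finset.mem_filter.2 ⟨Nat.mem_primeFactors.2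
        ⟨hp, (dvd_pow_self p two_ne_zero).trans hpn, hn⟩, hpT, hpn⟩
      have := Finset.dvd_prod_of_mem (fun p => p) hpP
      rw [← hR, h] at this
      exact hp.one_lt.ne' (Nat.dvd_one.1 this)
    · intro h
      have : P = ∅ := Finset.filter_eq_empty_iff.2 fun p hp hh =>
        h p (Nat.prime_of_mem_primeFactors hp) hh.1 hh.2
      rw [hR, this, Finset.prod_empty]
  simp only [h3]
  split_ifs <;> simp

theorem squarefree_iff_forall_prime_not_sq_dvd {n : ℕ} :
    Squarefree n ↔ ∀ p : ℕ, p.Prime → ¬ p ∣ 1 → ¬ p ^ 2 ∣ n := by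
  rw [Nat.squarefree_iff_prime_squarefree]
  refine forall₂_congr fun p hp => ?_
  rw [sq, Nat.dvd_one]
  exact ⟨fun h _ => h, fun h => h hp.one_lt.ne'⟩

/-! ### Counting in residue classes -/

theorem abs_card_filter_modEq_sub_div_le {N r : ℕ} (hr : 0 < r) (v : ℕ) :
    |(((Finset.Ioc 0 N).filter (fun x => x ≡ v [MOD r])).card : ℝ) - N / r| ≤ 1 := by
  have h := Nat.Ioc_filter_modEq_card 0 N hr v
  have h1 := Int.floor_le (((N : ℚ) - v) / r)
  have h2 := Int.lt_floor_add_one (((N : ℚ) - v) / r)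
  have h3 := Int.floor_le ((((0 : ℕ) : ℚ) - v) / r)
  have h4 := Int.lt_floor_add_one ((((0 : ℕ) : ℚ) - v) / r)
  have h5 : ((N : ℚ) - v) / r = N / r + (((0 : ℕ) : ℚ) - v) / r := by
    rw [← add_div]; push_cast; ring
  have h6 : (0 : ℚ) ≤ N / r := by positivity
  rw [max_eq_left (sub_nonneg.2 (Int.floor_le_floor (by linarith)))] at h
  have h' : (((Finset.Ioc 0 N).filter (fun x => x ≡ v [MOD r])).card : ℚ) =
      ⌊((N : ℚ) - v) / r⌋ - ⌊(((0 : ℕ) : ℚ) - v) / r⌋ := by exact_mod_cast h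
  have key : |(((Finset.Ioc 0 N).filter (fun x => x ≡ v [MOD r])).card : ℚ) - N / r| ≤ 1 := by
    rw [h', abs_le]
    constructor <;> linarith
  have := (Rat.cast_le (K := ℝ)).2 key
  push_cast at this
  exact this

/-- Counting the multiples of `L` in a residue class. -/
theorem abs_card_filter_dvd_sub_div_le {N L M : ℕ} {a b : ℤ} (hL : 0 < L) (hM : 0 < M)
    (hLM : L.Coprime M) (hb : IsCoprime b M) :
    |(((Finset.Ioc 0 N).filter (fun x : ℕ => L ∣ x ∧ (M : ℤ) ∣ a + b * x)).card : ℝ)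
      - N / (L * M : ℕ)| ≤ 1 := by
  -- `b'` inverts `b` modulo `M`; by the Chinese remainder theorem the two conditions form one
  -- class: 0 mod `L` and -b'a mod `M`.
  obtain ⟨b', m', hb'⟩ := hb
  obtain ⟨v, hvL, hvM⟩ := Nat.chineseRemainder hLM 0 ((-(b' * a)) % M).toNat
  have hMz : (M : ℤ) ≠ 0 := by exact_mod_cast hM.ne'
  have hvM' : (v : ℤ) ≡ -(b' * a) [ZMOD M] := by
    have h := Int.natCast_modEq_iff.2 hvM
    rw [Int.toNat_of_nonneg (Int.emod_nonneg _ hMz)] at h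
    exact h.trans (Int.mod_modEq _ _)
  have hset : (Finset.Ioc 0 N).filter (fun x : ℕ => L ∣ x ∧ (M : ℤ) ∣ a + b * x) =
      (Finset.Ioc 0 N).filter (fun x => x ≡ v [MOD L * M]) := by
    refine Finset.filter_congr fun x _ => ?_
    rw [← Nat.modEq_and_modEq_iff_modEq_mul hLM]
    refine and_congr ?_ ?_
    · rw [← Nat.modEq_zero_iff_dvd]
      exact ⟨fun h => h.trans hvL.symm, fun h => h.trans hvL⟩
    · rw [← Int.natCast_modEq_iff]
      constructor
      · intro h
        refine Int.ModEq.trans ?_ hvM'.symm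
        rw [Int.modEq_iff_dvd]
        obtain ⟨q, hq⟩ := h
        exact ⟨-b' * q - m' * x, by linear_combination (-b') * hq + (x : ℤ) * hb'⟩
      · intro h
        have h' := h.trans hvM'
        rw [Int.modEq_iff_dvd] at h'
        obtain ⟨q, hq⟩ := h'
        exact ⟨-b * q + m' * a, by linear_combination (-b) * hq - a * hb'⟩
  rw [hset]
  exact abs_card_filter_modEq_sub_div_le (Nat.mul_pos hL hM) v

/-! ### The two-variable sieve -/

/-- The density attached to a pair `(d, e)` of square divisors in the sieve. -/
noncomputable def sieveWeight (κ T : ℕ) (x : ℕ × ℕ) : ℝ :=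
  if x.1.Coprime x.2 then
    coprimeMoebius 1 x.1 * coprimeMoebius T x.2 / ((Nat.lcm κ (x.1 ^ 2) * x.2 ^ 2 : ℕ) : ℝ)
  else 0

open Classical in
/-- The squarefree multiples `A ≤ N` of `κ` such that `a + b A` has no square factor `p ^ 2` with
`p` prime to `T`. -/
noncomputable def sievedSet (κ T : ℕ) (a b : ℤ) (N : ℕ) : Finset ℕ :=
  (Finset.Ioc 0 N).filter fun A => κ ∣ A ∧ Squarefree A ∧
    ∀ p : ℕ, p.Prime → ¬ p ∣ T → ¬ (p : ℤ) ^ 2 ∣ a + b * A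

theorem mem_sievedSet {κ T : ℕ} {a b : ℤ} {N A : ℕ} :
    A ∈ sievedSet κ T a b N ↔ A ∈ Finset.Ioc 0 N ∧ κ ∣ A ∧ Squarefree A ∧
      ∀ p : ℕ, p.Prime → ¬ p ∣ T → ¬ (p : ℤ) ^ 2 ∣ a + b * A := by
  classical
  exact Finset.mem_filter

theorem abs_sieveWeight_le {κ T : ℕ} (hκ : κ ≠ 0) (x : ℕ × ℕ) :
    |sieveWeight κ T x| ≤ ((x.1 : ℝ) ^ 2)⁻¹ * ((x.2 : ℝ) ^ 2)⁻¹ := by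
  unfold sieveWeight
  have h0 : (0 : ℝ) ≤ ((x.1 : ℝ) ^ 2)⁻¹ * ((x.2 : ℝ) ^ 2)⁻¹ := by positivity
  split_ifs with hc
  swap
  · simpa using h0
  rcases eq_or_ne x.1 0 with h1 | h1
  · simp [h1]
  rcases eq_or_ne x.2 0 with h2 | h2
  · simp [h2]
  have hle : x.1 ^ 2 ≤ Nat.lcm κ (x.1 ^ 2) :=
    Nat.le_of_dvd (Nat.pos_of_ne_zero (Nat.lcm_ne_zero hκ (pow_ne_zero 2 h1))) (Nat.dvd_lcm_right _ _)
  have hle' : ((x.1 : ℝ) ^ 2) ≤ (Nat.lcm κ (x.1 ^ 2) : ℝ) := by exact_mod_cast hle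
  have hp1 : (0 : ℝ) < (x.1 : ℝ) ^ 2 := by positivity
  have hp2 : (0 : ℝ) < (x.2 : ℝ) ^ 2 := by positivity
  rw [abs_div, abs_mul, Nat.abs_cast, ← mul_inv, ← one_div]
  push_cast
  refine div_le_div₀ zero_le_one ?_ (by positivity) (by gcongr)
  exact mul_le_one₀ (abs_coprimeMoebius_le_one _ _) (abs_nonneg _) (abs_coprimeMoebius_le_one _ _)

section Sieve

variable {κ T : ℕ} {a b : ℤ}

theorem card_filter_linear_eq_zero_le_one (hb : b ≠ 0) (S : Finset ℕ) :
    (S.filter (fun A : ℕ => a + b * A = 0)).card ≤ 1 := by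
  refine Finset.card_le_one.2 fun x hx y hy => ?_
  have hx' := (Finset.mem_filter.1 hx).2
  have hy' := (Finset.mem_filter.1 hy).2
  have : b * x = b * y := by linarith
  exact_mod_cast mul_left_cancel₀ hb this

open Classical in
-- Of the error 2, one unit is the residue-class count and one is the possible A with a + bA = 0. If
-- a prime p divides both d and e, no A qualifies: p would divide A and a + bA, hence a.
theorem abs_moebius_mul_card_sub_weight_le (hκ : κ ≠ 0) (hκT : κ ∣ T) (hb : b ≠ 0)
    (hab : ∀ p : ℕ, p.Prime → ¬ p ∣ T → ¬ (p : ℤ) ∣ a ∧ ¬ (p : ℤ) ∣ b) (N : ℕ) {d e : ℕ}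
    (hd : 0 < d) (he : 0 < e) :
    |coprimeMoebius 1 d * coprimeMoebius T e * (((Finset.Ioc 0 N).filter (fun A : ℕ =>
      (a + b * A ≠ 0 ∧ κ ∣ A) ∧ d ^ 2 ∣ A ∧ e ^ 2 ∣ (a + b * A).natAbs)).card : ℝ) -
        N * sieveWeight κ T (d, e)| ≤ 2 := by
  by_cases h0 : coprimeMoebius 1 d * coprimeMoebius T e = 0
  · simp [sieveWeight, h0]
  obtain ⟨heT, -⟩ := coprime_and_squarefree_of_coprimeMoebius_ne_zero (right_ne_zero_of_mul h0)
  have hnat : ∀ A : ℕ, e ^ 2 ∣ (a + b * A).natAbs ↔ ((e ^ 2 : ℕ) : ℤ) ∣ a + b * A := fun A =>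
    Int.natCast_dvd.symm
  have hpT : ∀ p : ℕ, p.Prime → p ∣ e → ¬ p ∣ T := fun p hp hpe =>
    (hp.coprime_iff_not_dvd).1 (Nat.Coprime.coprime_dvd_left hpe heT)
  simp only [sieveWeight]
  split_ifs with hde
  · have hLM : (Nat.lcm κ (d ^ 2)).Coprime (e ^ 2) := by
      refine Nat.Coprime.coprime_dvd_left (Nat.lcm_dvd_mul _ _) (Nat.Coprime.mul_left ?_ ?_)
      · exact (Nat.Coprime.coprime_dvd_left hκT heT.symm).pow_right 2
      · exact hde.pow 2 2
    have hbe : IsCoprime b ((e ^ 2 : ℕ) : ℤ) := by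
      push_cast
      refine IsCoprime.pow_right ?_
      rw [Int.isCoprime_iff_gcd_eq_one]
      refine Nat.coprime_of_dvd fun p hp h1 h2 => ?_
      have h2' : p ∣ e := by simpa using h2
      exact (hab p hp (hpT p hp h2')).2 (Int.natCast_dvd.2 h1)
    have hL : 0 < Nat.lcm κ (d ^ 2) :=
      Nat.pos_of_ne_zero (Nat.lcm_ne_zero hκ (pow_ne_zero 2 hd.ne'))
    have h1 := abs_card_filter_dvd_sub_div_le (N := N) (a := a) hL (by positivity : 0 < e ^ 2)
      hLM hbe
    set U := (Finset.Ioc 0 N).filter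
      (fun x : ℕ => Nat.lcm κ (d ^ 2) ∣ x ∧ ((e ^ 2 : ℕ) : ℤ) ∣ a + b * x) with hU
    have h2 : (Finset.Ioc 0 N).filter (fun A : ℕ => (a + b * A ≠ 0 ∧ κ ∣ A) ∧ d ^ 2 ∣ A ∧
        e ^ 2 ∣ (a + b * A).natAbs) = U.filter (fun A : ℕ => ¬ a + b * A = 0) := by
      rw [hU, Finset.filter_filter]
      refine Finset.filter_congr fun A _ => ?_
      rw [Nat.lcm_dvd_iff, hnat]
      tauto
    have h3 := Finset.card_filter_add_card_filter_not (s := U) (fun A : ℕ => a + b * A = 0)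
    have h4 := card_filter_linear_eq_zero_le_one (a := a) hb U
    rw [h2]
    have h5 : |((U.filter (fun A : ℕ => ¬ a + b * A = 0)).card : ℝ) -
        N / (Nat.lcm κ (d ^ 2) * e ^ 2 : ℕ)| ≤ 2 := by
      have h3' : ((U.filter (fun A : ℕ => a + b * A = 0)).card : ℝ) +
        (U.filter (fun A : ℕ => ¬ a + b * A = 0)).card = U.card := by exact_mod_cast h3
      have h4' : ((U.filter (fun A : ℕ => a + b * A = 0)).card : ℝ) ≤ 1 := by exact_mod_cast h4
      have h4'' : (0 : ℝ) ≤ ((U.filter (fun A : ℕ => a + b * A = 0)).card : ℝ) := Nat.cast_nonneg _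
      rw [abs_le] at h1 ⊢
      constructor <;> linarith
    have h6 : |coprimeMoebius 1 d * coprimeMoebius T e| ≤ 1 := by
      rw [abs_mul]
      exact mul_le_one₀ (abs_coprimeMoebius_le_one _ _) (abs_nonneg _)
        (abs_coprimeMoebius_le_one _ _)
    calc _ = |coprimeMoebius 1 d * coprimeMoebius T e| *
        |((U.filter (fun A : ℕ => ¬ a + b * A = 0)).card : ℝ) -
          N / (Nat.lcm κ (d ^ 2) * e ^ 2 : ℕ)| := by
          rw [← abs_mul]
          congr 1
          ring
      _ ≤ 1 * 2 := by gcongr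
      _ = 2 := by norm_num
  · rw [Finset.filter_false_of_mem]
    · simp
    · rintro A - ⟨-, hdA, heA⟩
      rw [hnat] at heA
      obtain ⟨p, hp, hpd, hpe⟩ := Nat.Prime.not_coprime_iff_dvd.1 hde
      have h1 : (p : ℤ) ∣ A := by
        exact_mod_cast (hpd.trans (dvd_pow_self d two_ne_zero)).trans hdA
      have h2 : (p : ℤ) ∣ a + b * A :=
        (Int.natCast_dvd_natCast.2 (hpe.trans (dvd_pow_self e two_ne_zero))).trans heA
      exact (hab p hp (hpT p hp hpe)).1 ((dvd_add_left (h1.mul_left b)).1 h2)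

open Classical in
theorem card_sievedSet_eq_sum (hT : T ≠ 0) {N E : ℕ}
    (hE : ∀ A ∈ Finset.Ioc 0 N, (a + b * A).natAbs ≤ E ^ 2) :
    ((sievedSet κ T a b N).card : ℝ) =
      ∑ A ∈ (Finset.Ioc 0 N).filter (fun A : ℕ => a + b * A ≠ 0 ∧ κ ∣ A),
        (∑ d ∈ (Finset.Ioc 0 N).filter (fun d => d ^ 2 ∣ A), coprimeMoebius 1 d) *
          ∑ e ∈ (Finset.Ioc 0 E).filter (fun e => e ^ 2 ∣ (a + b * A).natAbs),
            coprimeMoebius T e := by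
  have h1 : ∀ A ∈ (Finset.Ioc 0 N).filter (fun A : ℕ => a + b * A ≠ 0 ∧ κ ∣ A),
      (∑ d ∈ (Finset.Ioc 0 N).filter (fun d => d ^ 2 ∣ A), coprimeMoebius 1 d) *
          ∑ e ∈ (Finset.Ioc 0 E).filter (fun e => e ^ 2 ∣ (a + b * A).natAbs),
            coprimeMoebius T e =
      if Squarefree A ∧ ∀ p : ℕ, p.Prime → ¬ p ∣ T → ¬ (p : ℤ) ^ 2 ∣ a + b * A then 1 else 0 := by
    intro A hA
    obtain ⟨hA1, hA2, -⟩ := Finset.mem_filter.1 hA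
    obtain ⟨hA3, hA4⟩ := Finset.mem_Ioc.1 hA1
    rw [sum_coprimeMoebius_filter hA3.ne' (hA4.trans (Nat.le_self_pow two_ne_zero N)),
      sum_coprimeMoebius_filter (Int.natAbs_ne_zero.2 hA2) (hE A hA1),
      ← squarefree_iff_forall_prime_not_sq_dvd, ite_and]
    have h2 : (∀ p : ℕ, p.Prime → ¬ p ∣ T → ¬ p ^ 2 ∣ (a + b * A).natAbs) ↔
        ∀ p : ℕ, p.Prime → ¬ p ∣ T → ¬ (p : ℤ) ^ 2 ∣ a + b * A := by
      refine forall₃_congr fun p _ _ => ?_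
      rw [← Int.natCast_dvd, Nat.cast_pow]
    simp only [h2]
    split_ifs <;> simp
  rw [Finset.sum_congr rfl h1, Finset.sum_boole, Finset.filter_filter]
  congr 2
  refine Finset.filter_congr fun A _ => ?_
  constructor
  · rintro ⟨hκ, hsq, hp⟩
    refine ⟨⟨fun h0 => ?_, hκ⟩, hsq, hp⟩
    -- Zero is divisible by p² for a prime p > T, so an A with a + bA = 0 is never sieved in.
    obtain ⟨p, hpT, hpp⟩ := Nat.exists_infinite_primes (T + 1)
    refine hp p hpp (fun hd => ?_) (by rw [h0]; exact dvd_zero _)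
    have := Nat.le_of_dvd (Nat.pos_of_ne_zero hT) hd
    omega
  · rintro ⟨⟨-, hκ⟩, hsq, hp⟩
    exact ⟨hκ, hsq, hp⟩

open Classical in
-- Only d is truncated. The complete sum over e is an indicator, hence at most 1 in size, so the
-- terms d > Z cost at most ∑ N/d² ≤ N/Z; the ZE remaining pairs cost 2 each.
theorem abs_card_sievedSet_sub_le (hκ : κ ≠ 0) (hκT : κ ∣ T) (hT : T ≠ 0) (hb : b ≠ 0)
    (hab : ∀ p : ℕ, p.Prime → ¬ p ∣ T → ¬ (p : ℤ) ∣ a ∧ ¬ (p : ℤ) ∣ b) {N Z E : ℕ} (hZ : 0 < Z)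
    (hZN : Z ≤ N) (hE : ∀ A ∈ Finset.Ioc 0 N, (a + b * A).natAbs ≤ E ^ 2) :
    |((sievedSet κ T a b N).card : ℝ) -
      N * ∑ x ∈ Finset.Ioc 0 Z ×ˢ Finset.Ioc 0 E, sieveWeight κ T x| ≤ N / Z + 2 * (Z * E) := by
  set S := (Finset.Ioc 0 N).filter (fun A : ℕ => a + b * A ≠ 0 ∧ κ ∣ A) with hS
  set F : ℕ → ℕ → ℝ := fun Y A =>
    ∑ d ∈ (Finset.Ioc 0 Y).filter (fun d => d ^ 2 ∣ A), coprimeMoebius 1 d with hF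
  set g : ℕ → ℝ := fun A =>
    ∑ e ∈ (Finset.Ioc 0 E).filter (fun e => e ^ 2 ∣ (a + b * A).natAbs), coprimeMoebius T e with hg
  have hcard : ((sievedSet κ T a b N).card : ℝ) = ∑ A ∈ S, F N A * g A :=
    card_sievedSet_eq_sum hT hE
  have hg1 : ∀ A ∈ S, |g A| ≤ 1 := by
    intro A hA
    obtain ⟨hA1, hA2, -⟩ := Finset.mem_filter.1 hA
    rw [hg]
    simp only
    rw [sum_coprimeMoebius_filter (Int.natAbs_ne_zero.2 hA2) (hE A hA1)]
    split_ifs <;> simp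
  have hsplit : ∀ A, F N A = F Z A +
      ∑ d ∈ (Finset.Ioc Z N).filter (fun d => d ^ 2 ∣ A), coprimeMoebius 1 d := by
    intro A
    rw [hF]
    simp only
    rw [← Finset.Ioc_union_Ioc_eq_Ioc (Nat.zero_le Z) hZN, Finset.filter_union,
      Finset.sum_union (Finset.disjoint_filter_filter (Finset.Ioc_disjoint_Ioc_of_le le_rfl))]
  have htail : |∑ A ∈ S, F N A * g A - ∑ A ∈ S, F Z A * g A| ≤ N / Z := by
    rw [← Finset.sum_sub_distrib]
    calc |∑ A ∈ S, (F N A * g A - F Z A * g A)|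
        ≤ ∑ A ∈ S, |F N A * g A - F Z A * g A| := Finset.abs_sum_le_sum_abs _ _
      _ ≤ ∑ A ∈ S, ∑ d ∈ Finset.Ioc Z N, if d ^ 2 ∣ A then (1 : ℝ) else 0 := by
          refine Finset.sum_le_sum fun A hA => ?_
          rw [hsplit, add_mul, add_sub_cancel_left, abs_mul, ← Finset.sum_filter]
          refine (mul_le_of_le_one_right (abs_nonneg _) (hg1 A hA)).trans ?_
          exact (Finset.abs_sum_le_sum_abs _ _).trans
            (Finset.sum_le_sum fun d _ => abs_coprimeMoebius_le_one _ _)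
      _ ≤ ∑ A ∈ Finset.Ioc 0 N, ∑ d ∈ Finset.Ioc Z N, if d ^ 2 ∣ A then (1 : ℝ) else 0 := by
          refine Finset.sum_le_sum_of_subset_of_nonneg (Finset.filter_subset _ _) fun A _ _ => ?_
          exact Finset.sum_nonneg fun d _ => by split_ifs <;> norm_num
      _ = ∑ d ∈ Finset.Ioc Z N, ((N / d ^ 2 : ℕ) : ℝ) := by
          rw [Finset.sum_comm]
          refine Finset.sum_congr rfl fun d _ => ?_
          rw [Finset.sum_boole, Nat.Ioc_filter_dvd_card_eq_div]
      _ ≤ ∑ d ∈ Finset.Ioc Z N, (N : ℝ) * ((d : ℝ) ^ 2)⁻¹ := by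
          refine Finset.sum_le_sum fun d _ => ?_
          rw [← div_eq_mul_inv]
          exact_mod_cast Nat.cast_div_le (α := ℝ) (m := N) (n := d ^ 2)
      _ ≤ N / Z := by
          rw [← Finset.mul_sum, div_eq_mul_inv]
          refine mul_le_mul_of_nonneg_left ?_ (Nat.cast_nonneg _)
          refine (sum_Ioc_inv_sq_le_sub hZ.ne' hZN).trans ?_
          simp
  have hswap : ∑ A ∈ S, F Z A * g A = ∑ x ∈ Finset.Ioc 0 Z ×ˢ Finset.Ioc 0 E,
      coprimeMoebius 1 x.1 * coprimeMoebius T x.2 * (((Finset.Ioc 0 N).filter (fun A : ℕ =>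
      (a + b * A ≠ 0 ∧ κ ∣ A) ∧ x.1 ^ 2 ∣ A ∧ x.2 ^ 2 ∣ (a + b * A).natAbs)).card : ℝ) := by
    have h1 : ∀ A, F Z A * g A = ∑ x ∈ Finset.Ioc 0 Z ×ˢ Finset.Ioc 0 E,
        if x.1 ^ 2 ∣ A ∧ x.2 ^ 2 ∣ (a + b * A).natAbs then
          coprimeMoebius 1 x.1 * coprimeMoebius T x.2 else 0 := by
      intro A
      rw [hF, hg]
      simp only
      rw [Finset.sum_filter, Finset.sum_filter, Finset.sum_mul_sum, ← Finset.sum_product']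
      refine Finset.sum_congr rfl fun x _ => ?_
      rw [ite_and]
      split_ifs <;> simp
    simp only [h1]
    rw [Finset.sum_comm]
    refine Finset.sum_congr rfl fun x _ => ?_
    rw [← Finset.sum_filter, Finset.sum_const, nsmul_eq_mul, mul_comm, hS, Finset.filter_filter]
  have hmain : |∑ A ∈ S, F Z A * g A -
      N * ∑ x ∈ Finset.Ioc 0 Z ×ˢ Finset.Ioc 0 E, sieveWeight κ T x| ≤ 2 * (Z * E) := by
    rw [hswap, Finset.mul_sum, ← Finset.sum_sub_distrib]
    refine (Finset.abs_sum_le_sum_abs _ _).trans ((Finset.sum_le_card_nsmul _ _ 2 ?_).trans ?_)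
    · rintro ⟨d, e⟩ hx
      obtain ⟨hd, he⟩ := Finset.mem_product.1 hx
      exact abs_moebius_mul_card_sub_weight_le hκ hκT hb hab N (Finset.mem_Ioc.1 hd).1
        (Finset.mem_Ioc.1 he).1
    · rw [Finset.card_product, Nat.card_Ioc, Nat.card_Ioc, nsmul_eq_mul]
      push_cast
      simp only [Nat.sub_zero]
      linarith
  rw [hcard]
  calc _ = |(∑ A ∈ S, F N A * g A - ∑ A ∈ S, F Z A * g A) + (∑ A ∈ S, F Z A * g A -
      N * ∑ x ∈ Finset.Ioc 0 Z ×ˢ Finset.Ioc 0 E, sieveWeight κ T x)| := by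
        congr 1; ring
    _ ≤ _ := (abs_add_le _ _).trans (add_le_add htail hmain)

end Sieve

/-! ### Convergence and truncation of the density sum -/

theorem summable_inv_sq_mul_inv_sq :
    Summable fun x : ℕ × ℕ => ((x.1 : ℝ) ^ 2)⁻¹ * ((x.2 : ℝ) ^ 2)⁻¹ := by
  have h : Summable fun n : ℕ => ((n : ℝ) ^ 2)⁻¹ := Real.summable_nat_pow_inv.2 one_lt_two
  exact h.mul_of_nonneg h (fun n => by positivity) (fun n => by positivity)

theorem summable_sieveWeight {κ T : ℕ} (hκ : κ ≠ 0) : Summable (sieveWeight κ T) :=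
  Summable.of_norm_bounded summable_inv_sq_mul_inv_sq fun x => abs_sieveWeight_le hκ x

theorem sum_Ioc_zero_inv_sq_le_two (M : ℕ) : ∑ i ∈ Finset.Ioc 0 M, ((i : ℝ) ^ 2)⁻¹ ≤ 2 := by
  have h := sum_Ioo_inv_sq_le (α := ℝ) 0 (M + 1)
  have : Finset.Ioo 0 (M + 1) = Finset.Ioc 0 M := by ext; simp
  rw [this] at h
  simpa using h

/-- Truncating the density sum to a box. -/
theorem abs_tsum_sieveWeight_sub_le {κ T : ℕ} (hκ : κ ≠ 0) {Z E : ℕ} (hZ : 0 < Z) (hE : 0 < E) :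
    |∑' x, sieveWeight κ T x - ∑ x ∈ Finset.Ioc 0 Z ×ˢ Finset.Ioc 0 E, sieveWeight κ T x| ≤
      2 / Z + 2 / E := by
  have hzero : ∀ x : ℕ × ℕ, x.1 = 0 ∨ x.2 = 0 → sieveWeight κ T x = 0 := by
    intro x hx
    have := abs_sieveWeight_le (T := T) hκ x
    rcases hx with h | h <;> simpa [h] using this
  -- Exhausting ℕ × ℕ by squares reduces the infinite tail to finite sums with a bound uniform in M.
  have hbox : Filter.Tendsto (fun M : ℕ => Finset.range (M + 1) ×ˢ Finset.range (M + 1))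
      Filter.atTop (Filter.atTop : Filter (Finset (ℕ × ℕ))) := by
    refine Filter.tendsto_atTop_finset_of_monotone (fun M M' h => ?_) fun x =>
      ⟨max x.1 x.2, ?_⟩
    · exact Finset.product_subset_product (Finset.range_mono (by omega))
        (Finset.range_mono (by omega))
    · simp
  have hlim := ((summable_sieveWeight (T := T) hκ).hasSum.comp hbox).sub_const
    (∑ x ∈ Finset.Ioc 0 Z ×ˢ Finset.Ioc 0 E, sieveWeight κ T x)
  refine le_of_tendsto hlim.abs (Filter.eventually_atTop.2 ⟨max Z E, fun M hM => ?_⟩)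
  have hMZ : Z ≤ M := (le_max_left _ _).trans hM
  have hME : E ≤ M := (le_max_right _ _).trans hM
  have h1 : ∑ x ∈ Finset.range (M + 1) ×ˢ Finset.range (M + 1), sieveWeight κ T x =
      ∑ x ∈ Finset.Ioc 0 M ×ˢ Finset.Ioc 0 M, sieveWeight κ T x := by
    symm
    refine Finset.sum_subset (fun x hx => ?_) fun x hx hx' => hzero x ?_
    · simp only [Finset.mem_product, Finset.mem_Ioc, Finset.mem_range] at hx ⊢
      omega
    · simp only [Finset.mem_product, Finset.mem_Ioc, Finset.mem_range] at hx hx'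
      omega
  have hsub : Finset.Ioc 0 Z ×ˢ Finset.Ioc 0 E ⊆ Finset.Ioc 0 M ×ˢ Finset.Ioc 0 M :=
    Finset.product_subset_product (Finset.Ioc_subset_Ioc_right hMZ)
      (Finset.Ioc_subset_Ioc_right hME)
  simp only [Function.comp_apply]
  rw [h1, ← Finset.sum_sdiff hsub, add_sub_cancel_right]
  have hcover : (Finset.Ioc 0 M ×ˢ Finset.Ioc 0 M) \ (Finset.Ioc 0 Z ×ˢ Finset.Ioc 0 E) ⊆
      Finset.Ioc Z M ×ˢ Finset.Ioc 0 M ∪ Finset.Ioc 0 M ×ˢ Finset.Ioc E M := by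
    intro x hx
    simp only [Finset.mem_sdiff, Finset.mem_union, Finset.mem_product, Finset.mem_Ioc] at hx ⊢
    omega
  have hnn : ∀ x : ℕ × ℕ, 0 ≤ ((x.1 : ℝ) ^ 2)⁻¹ * ((x.2 : ℝ) ^ 2)⁻¹ := fun x => by positivity
  have htail : ∀ Y : ℕ, 0 < Y → Y ≤ M → ∑ i ∈ Finset.Ioc Y M, ((i : ℝ) ^ 2)⁻¹ ≤ 1 / Y := by
    intro Y hY hYM
    refine (sum_Ioc_inv_sq_le_sub hY.ne' hYM).trans ?_
    simp
  calc _ ≤ ∑ x ∈ (Finset.Ioc 0 M ×ˢ Finset.Ioc 0 M) \ (Finset.Ioc 0 Z ×ˢ Finset.Ioc 0 E),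
        ((x.1 : ℝ) ^ 2)⁻¹ * ((x.2 : ℝ) ^ 2)⁻¹ :=
        (Finset.abs_sum_le_sum_abs _ _).trans
          (Finset.sum_le_sum fun x _ => abs_sieveWeight_le hκ x)
    _ ≤ ∑ x ∈ Finset.Ioc Z M ×ˢ Finset.Ioc 0 M ∪ Finset.Ioc 0 M ×ˢ Finset.Ioc E M,
        ((x.1 : ℝ) ^ 2)⁻¹ * ((x.2 : ℝ) ^ 2)⁻¹ :=
        Finset.sum_le_sum_of_subset_of_nonneg hcover fun x _ _ => hnn x
    _ ≤ ∑ x ∈ Finset.Ioc Z M ×ˢ Finset.Ioc 0 M, ((x.1 : ℝ) ^ 2)⁻¹ * ((x.2 : ℝ) ^ 2)⁻¹ +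
        ∑ x ∈ Finset.Ioc 0 M ×ˢ Finset.Ioc E M, ((x.1 : ℝ) ^ 2)⁻¹ * ((x.2 : ℝ) ^ 2)⁻¹ := by
        rw [← Finset.sum_union_inter]
        exact le_add_of_nonneg_right (Finset.sum_nonneg fun x _ => hnn x)
    _ ≤ 1 / Z * 2 + 2 * (1 / E) := by
        rw [Finset.sum_product, Finset.sum_product]
        simp only
        rw [← Finset.sum_mul_sum, ← Finset.sum_mul_sum]
        have h2 : ∀ Y, 0 ≤ ∑ i ∈ Finset.Ioc Y M, ((i : ℝ) ^ 2)⁻¹ := fun Y =>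
          Finset.sum_nonneg fun i _ => by positivity
        exact add_le_add
          (mul_le_mul (htail Z hZ hMZ) (sum_Ioc_zero_inv_sq_le_two M) (h2 0) (by positivity))
          (mul_le_mul (sum_Ioc_zero_inv_sq_le_two M) (htail E hE hME) (h2 E) (by positivity))
    _ = 2 / Z + 2 / E := by ring

/-! ### The density as an Euler product -/

/-- `d ↦ gcd(κ, d ^ 2) / d ^ 2`. -/
noncomputable def gcdDensity (κ : ℕ) : ArithmeticFunction ℝ :=
  ⟨fun d => (Nat.gcd κ (d ^ 2) : ℝ) / (d : ℝ) ^ 2, by simp⟩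

/-- `e ↦ 1 / e ^ 2` on the integers coprime to `T`. -/
noncomputable def coprimeDensity (T : ℕ) : ArithmeticFunction ℝ :=
  ⟨fun e => if e.Coprime T then ((e : ℝ) ^ 2)⁻¹ else 0, by simp⟩

theorem gcdDensity_apply (κ d : ℕ) :
    gcdDensity κ d = (Nat.gcd κ (d ^ 2) : ℝ) / (d : ℝ) ^ 2 := rfl

theorem coprimeDensity_apply (T e : ℕ) :
    coprimeDensity T e = if e.Coprime T then ((e : ℝ) ^ 2)⁻¹ else 0 := rfl

theorem isMultiplicative_gcdDensity (κ : ℕ) : (gcdDensity κ).IsMultiplicative := by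
  refine ⟨by simp [gcdDensity_apply], fun {m n} hmn => ?_⟩
  rw [gcdDensity_apply, gcdDensity_apply, gcdDensity_apply, mul_pow,
    Nat.Coprime.gcd_mul κ (hmn.pow 2 2)]
  push_cast
  rw [mul_pow, mul_div_mul_comm]

theorem isMultiplicative_coprimeDensity (T : ℕ) : (coprimeDensity T).IsMultiplicative := by
  refine ⟨by simp [coprimeDensity_apply], fun {m n} _ => ?_⟩
  simp only [coprimeDensity_apply, Nat.coprime_mul_iff_left, Nat.cast_mul, mul_pow, mul_inv,
    ite_and]
  split_ifs <;> simp

/-- Use lcm(κ, d²) = κd²/gcd(κ, d²). The factor μ(de) vanishes unless d and e are coprime, absorbing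
that condition and allowing pairs to be grouped by q = de. -/
theorem sieveWeight_eq {κ T : ℕ} (hκ : κ ≠ 0) (x : ℕ × ℕ) :
    sieveWeight κ T x = (κ : ℝ)⁻¹ * ((ArithmeticFunction.moebius (x.1 * x.2) : ℝ) *
      (gcdDensity κ x.1 * coprimeDensity T x.2)) := by
  obtain ⟨d, e⟩ := x
  simp only [sieveWeight, gcdDensity_apply, coprimeDensity_apply]
  split_ifs with h1 h2
  · rw [ArithmeticFunction.isMultiplicative_moebius.map_mul_of_coprime h1, coprimeMoebius,
      coprimeMoebius, if_pos h2, if_pos (Nat.coprime_one_right d)]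
    rcases eq_or_ne d 0 with rfl | hd
    · simp
    have hg : (Nat.gcd κ (d ^ 2) : ℝ) ≠ 0 := by
      exact_mod_cast Nat.gcd_ne_zero_left hκ
    have hlcm : (Nat.gcd κ (d ^ 2) : ℝ) * Nat.lcm κ (d ^ 2) = κ * (d : ℝ) ^ 2 := by
      exact_mod_cast Nat.gcd_mul_lcm κ (d ^ 2)
    have hlcm' : (Nat.lcm κ (d ^ 2) : ℝ) = κ * (d : ℝ) ^ 2 / Nat.gcd κ (d ^ 2) := by
      rw [eq_div_iff hg, mul_comm, hlcm]
    push_cast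
    rw [hlcm']
    field_simp
  · simp [coprimeMoebius, h2]
  all_goals
    rw [ArithmeticFunction.moebius_eq_zero_of_not_squarefree fun h =>
      h1 (Nat.squarefree_mul_iff.1 h).1]
    simp

/-- The coefficients of the Euler product of the sieve density. -/
noncomputable def sieveCoeff (κ T : ℕ) : ArithmeticFunction ℝ :=
  (ArithmeticFunction.moebius : ArithmeticFunction ℝ).pmul (gcdDensity κ * coprimeDensity T)

theorem isMultiplicative_sieveCoeff (κ T : ℕ) : (sieveCoeff κ T).IsMultiplicative :=
  ArithmeticFunction.isMultiplicative_moebius.intCast.pmul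
    ((isMultiplicative_gcdDensity κ).mul (isMultiplicative_coprimeDensity T))

theorem sieveCoeff_apply (κ T q : ℕ) : sieveCoeff κ T q = (ArithmeticFunction.moebius q : ℝ) *
    ∑ x ∈ q.divisorsAntidiagonal, gcdDensity κ x.1 * coprimeDensity T x.2 := by
  rw [sieveCoeff, ArithmeticFunction.pmul_apply, ArithmeticFunction.mul_apply,
    ArithmeticFunction.intCoe_apply]

theorem hasSum_sieveCoeff {κ T : ℕ} (hκ : κ ≠ 0) :
    HasSum (sieveCoeff κ T) (κ * ∑' x, sieveWeight κ T x) := by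
  have h := ((summable_sieveWeight (T := T) hκ).hasSum.tsum_fiberwise
    (fun x : ℕ × ℕ => x.1 * x.2)).mul_left (κ : ℝ)
  have hκ' : (κ : ℝ) ≠ 0 := Nat.cast_ne_zero.2 hκ
  refine h.congr_fun fun q => ?_
  rcases eq_or_ne q 0 with rfl | hq
  · have : ∀ x : ((fun x : ℕ × ℕ => x.1 * x.2) ⁻¹' {0}), sieveWeight κ T x = 0 := by
      rintro ⟨x, hx⟩
      have hx' : x.1 * x.2 = 0 := hx
      rw [sieveWeight_eq hκ]
      simp [hx']
    simp [this]
  · have hfib : ((fun x : ℕ × ℕ => x.1 * x.2) ⁻¹' {q}) = ↑(q.divisorsAntidiagonal) := by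
      ext x
      simp [hq]
    rw [hfib, Finset.tsum_subtype' q.divisorsAntidiagonal (sieveWeight κ T), sieveCoeff_apply,
      Finset.mul_sum, Finset.mul_sum]
    refine Finset.sum_congr rfl fun x hx => ?_
    rw [sieveWeight_eq hκ, (Nat.mem_divisorsAntidiagonal.1 hx).1, mul_inv_cancel_left₀ hκ']

/-- The Möbius factor kills all k ≥ 2; at q = p only (p, 1) and (1, p) contribute. -/
theorem tsum_sieveCoeff_prime_pow (κ T : ℕ) {p : ℕ} (hp : p.Prime) :
    ∑' k : ℕ, sieveCoeff κ T (p ^ k) = 1 - (gcdDensity κ p + coprimeDensity T p) := by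
  rw [tsum_eq_sum (s := Finset.range 2), Finset.sum_range_succ, Finset.sum_range_one, pow_zero,
    pow_one, (isMultiplicative_sieveCoeff κ T).map_one, sieveCoeff_apply,
    ArithmeticFunction.moebius_apply_prime hp,
    Nat.sum_divisorsAntidiagonal (fun i j => gcdDensity κ i * coprimeDensity T j),
    Nat.Prime.sum_divisors hp]
  · rw [Nat.div_self hp.pos, Nat.div_one, (isMultiplicative_gcdDensity κ).map_one,
      (isMultiplicative_coprimeDensity T).map_one]
    push_cast
    ring
  · intro k hk
    have hk' : ¬ k < 2 := by simpa using hk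
    rw [sieveCoeff_apply, ArithmeticFunction.moebius_apply_prime_pow hp (by omega),
      if_neg (by omega)]
    simp

theorem hasProd_sieve {κ T : ℕ} (hκ : κ ≠ 0) :
    HasProd (fun p : Nat.Primes => 1 - (gcdDensity κ p + coprimeDensity T p))
      (κ * ∑' x, sieveWeight κ T x) := by
  have hs := hasSum_sieveCoeff (T := T) hκ
  have h := EulerProduct.eulerProduct_hasProd (isMultiplicative_sieveCoeff κ T).map_one
    (fun {m n} hmn => (isMultiplicative_sieveCoeff κ T).map_mul_of_coprime hmn) hs.summable.norm
    ArithmeticFunction.map_zero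
  rw [hs.tsum_eq] at h
  exact h.congr_fun fun p => (tsum_sieveCoeff_prime_pow κ T p.2).symm

/-- Comparison: 1/(p² - 1) ≤ 2/p² for p ≥ 2. -/
theorem multipliable_eulerFactor (s : Set ℕ) (hs : ∀ p ∈ s, 2 ≤ p) :
    Multipliable (fun p : s => eulerFactor (p : ℕ)) := by
  have h : Summable fun n : ℕ => ((n : ℝ) ^ 2)⁻¹ := Real.summable_nat_pow_inv.2 one_lt_two
  have h1 : Summable fun p : s => -(1 / (((p : ℕ) : ℝ) ^ 2 - 1)) := by
    refine Summable.of_norm_bounded ((h.mul_left 2).subtype s) fun p => ?_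
    have hp : (2 : ℝ) ≤ (p : ℕ) := by exact_mod_cast hs p p.2
    rw [norm_neg, Real.norm_of_nonneg (one_div_nonneg.2 (by nlinarith))]
    simp only [Function.comp_apply]
    rw [← div_eq_mul_inv, div_le_div_iff₀ (by nlinarith) (by positivity)]
    nlinarith
  have h2 := multipliable_one_add_of_summable h1.norm
  simpa only [eulerFactor, sub_eq_add_neg] using h2

theorem gcdDensity_prime_of_dvd {κ p : ℕ} (hκ : Squarefree κ) (hp : p.Prime) (h : p ∣ κ) :
    gcdDensity κ p = 1 / p := by
  obtain ⟨k, rfl⟩ := h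
  have hk : k.Coprime p := (Nat.squarefree_mul_iff.1 hκ).1.symm
  have hp0 : (p : ℝ) ≠ 0 := Nat.cast_ne_zero.2 hp.ne_zero
  rw [gcdDensity_apply, sq p, Nat.gcd_mul_left, hk, mul_one]
  field_simp

theorem gcdDensity_prime_of_not_dvd {κ p : ℕ} (hp : p.Prime) (h : ¬ p ∣ κ) :
    gcdDensity κ p = 1 / (p : ℝ) ^ 2 := by
  have : Nat.gcd κ (p ^ 2) = 1 := (((hp.coprime_iff_not_dvd).2 h).symm.pow_right 2)
  rw [gcdDensity_apply, this, Nat.cast_one]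

open Classical in
/-- Evaluation of the sieve density. -/
theorem tsum_sieveWeight_eq {κ T : ℕ} (hκ : Squarefree κ) (hκT : κ ∣ T) :
    ∑' x, sieveWeight κ T x = 1 / ((κ : ℝ) * (riemannZeta 2).re) *
      (∏ p ∈ κ.primeFactors, (1 - 1 / ((p : ℝ) + 1))) *
      ∏' p : {p : ℕ | p.Prime ∧ ¬ p ∣ T}, eulerFactor (p : ℕ) := by
  have hκ0 : κ ≠ 0 := hκ.ne_zero
  set O : Set ℕ := {p : ℕ | p.Prime ∧ ¬ p ∣ T} with hO
  set g₁ : ℕ → ℝ := fun p => if p ∈ κ.primeFactors then 1 - 1 / ((p : ℝ) + 1) else 1 with hg₁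
  set g₂ : ℕ → ℝ := O.mulIndicator eulerFactor with hg₂
  have h1 : HasProd g₁ (∏ p ∈ κ.primeFactors, (1 - 1 / ((p : ℝ) + 1))) := by
    have : ∏ p ∈ κ.primeFactors, (1 - 1 / ((p : ℝ) + 1)) = ∏ p ∈ κ.primeFactors, g₁ p :=
      Finset.prod_congr rfl fun p hp => by rw [hg₁]; exact (if_pos hp).symm
    rw [this]
    exact hasProd_prod_of_ne_finset_one fun p hp => if_neg hp
  have h2 : HasProd g₂ (∏' p : O, eulerFactor (p : ℕ)) := by
    rw [hg₂, ← hasProd_subtype_iff_mulIndicator]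
    exact (multipliable_eulerFactor O fun p hp => hp.1.two_le).hasProd
  have h3 : HasProd (fun p : Nat.Primes => g₁ p * g₂ p)
      ((∏ p ∈ κ.primeFactors, (1 - 1 / ((p : ℝ) + 1))) * ∏' p : O, eulerFactor (p : ℕ)) := by
    have h := h1.mul h2
    have hsupp : {p : ℕ | p.Prime}.mulIndicator (fun p => g₁ p * g₂ p) = fun p => g₁ p * g₂ p := by
      refine Set.mulIndicator_eq_self.2 fun p hp => ?_
      by_contra hpp
      have hpp : ¬ p.Prime := hpp
      refine hp ?_
      simp [hg₁, hg₂, hO, hpp]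
    rw [← hsupp] at h
    exact hasProd_subtype_iff_mulIndicator.2 h
  have h4 := riemannZeta_eulerProduct_hasProd (s := 2) (by norm_num)
  have h5 := ((hasProd_sieve (T := T) hκ0).map Complex.ofRealHom Complex.continuous_ofReal).mul h4
  have h6 := h3.map Complex.ofRealHom Complex.continuous_ofReal
  have hzeta : riemannZeta 2 = ((riemannZeta 2).re : ℂ) := by
    rw [riemannZeta_two]
    norm_cast
  have hzeta0 : (riemannZeta 2).re ≠ 0 := by
    intro h0
    have := riemannZeta_ne_zero_of_one_lt_re (s := 2) (by norm_num)
    rw [hzeta, h0] at this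
    simp at this
  have h7 : ∀ p : ℕ, p.Prime → ((g₁ p * g₂ p : ℝ) : ℂ) =
      ((1 - (gcdDensity κ p + coprimeDensity T p) : ℝ) : ℂ) * (1 - (p : ℂ) ^ (-2 : ℂ))⁻¹ := by
    intro p hp
    have hp2 : (2 : ℝ) ≤ p := by exact_mod_cast hp.two_le
    have hp0 : (p : ℝ) ≠ 0 := by positivity
    have hpow : (p : ℂ) ^ (-2 : ℂ) = ((((p : ℝ) ^ 2)⁻¹ : ℝ) : ℂ) := by
      rw [Complex.cpow_neg, Complex.cpow_ofNat]
      push_cast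
      rfl
    have hne : (1 - ((p : ℝ) ^ 2)⁻¹) ≠ 0 := by
      have : ((p : ℝ) ^ 2)⁻¹ < 1 := inv_lt_one_of_one_lt₀ (by nlinarith)
      linarith
    have hne1 : (p : ℝ) ^ 2 - 1 ≠ 0 := by nlinarith
    have hne2 : (p : ℝ) + 1 ≠ 0 := by positivity
    -- The local factor is 1 - 1/p for p ∣ κ, 1 - 1/p² for p ∣ T with p ∤ κ, and 1 - 2/p² for p ∤ T.
    -- Dividing each by 1 - 1/p², the factor of 1/ζ(2), leaves the stated ones.
    have key : 1 - (gcdDensity κ p + coprimeDensity T p) =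
        (1 - ((p : ℝ) ^ 2)⁻¹) * (g₁ p * g₂ p) := by
      simp only [coprimeDensity_apply, hp.coprime_iff_not_dvd]
      by_cases hpκ : p ∣ κ
      · have hpT : p ∣ T := hpκ.trans hκT
        have e1 : g₁ p = 1 - 1 / ((p : ℝ) + 1) :=
          if_pos (Nat.mem_primeFactors.2 ⟨hp, hpκ, hκ0⟩)
        have e2 : g₂ p = 1 := Set.mulIndicator_of_notMem (fun h => h.2 hpT) _
        rw [gcdDensity_prime_of_dvd hκ hp hpκ, e1, e2, if_neg (not_not.2 hpT)]
        field_simp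
        ring
      · have e1 : g₁ p = 1 := if_neg fun h => hpκ (Nat.dvd_of_mem_primeFactors h)
        rw [gcdDensity_prime_of_not_dvd hp hpκ, e1]
        by_cases hpT : p ∣ T
        · have e2 : g₂ p = 1 := Set.mulIndicator_of_notMem (fun h => h.2 hpT) _
          rw [e2, if_neg (not_not.2 hpT)]
          field_simp
          ring
        · have e2 : g₂ p = eulerFactor p := Set.mulIndicator_of_mem (show p ∈ O from ⟨hp, hpT⟩) _
          rw [e2, if_pos hpT, eulerFactor]
          field_simp
          ring
    have hne' : (1 - ((((p : ℝ) ^ 2)⁻¹ : ℝ) : ℂ)) ≠ 0 := by exact_mod_cast hne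
    rw [key, hpow, Complex.ofReal_mul (1 - _), Complex.ofReal_sub, Complex.ofReal_one,
      mul_right_comm, mul_inv_cancel₀ hne', one_mul]
  have h8 := (h5.congr_fun fun p => h7 p p.2).unique h6
  rw [hzeta, Complex.ofRealHom_eq_coe, Complex.ofRealHom_eq_coe] at h8
  have h9 : κ * (∑' x, sieveWeight κ T x) * (riemannZeta 2).re =
    (∏ p ∈ κ.primeFactors, (1 - 1 / ((p : ℝ) + 1))) * ∏' p : O, eulerFactor (p : ℕ) := by
    exact_mod_cast h8
  have hκ' : (κ : ℝ) ≠ 0 := Nat.cast_ne_zero.2 hκ0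
  rw [mul_assoc, ← h9]
  field_simp

/-! ### Choice of parameters -/

theorem exists_abs_card_sievedSet_sub_le {κ T : ℕ} {a b : ℤ} (hκ : κ ≠ 0) (hκT : κ ∣ T)
    (hT : T ≠ 0) (hb : b ≠ 0)
    (hab : ∀ p : ℕ, p.Prime → ¬ p ∣ T → ¬ (p : ℤ) ∣ a ∧ ¬ (p : ℤ) ∣ b) :
    ∃ K : ℝ, ∀ X : ℝ, 1 ≤ X → |((sievedSet κ T a b ⌊X⌋₊).card : ℝ) -
      (∑' x, sieveWeight κ T x) * X| ≤ K * X ^ (3 / 4 : ℝ) := by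
  set W := ∑' x, sieveWeight κ T x with hW
  set c := a.natAbs + b.natAbs with hc
  have hc1 : 1 ≤ c := by have := Int.natAbs_pos.2 hb; omega
  -- With x = X^(1/4), Z ≈ x and E = cY, Y ≈ x²: 3N/Z gives 6x³, 2ZE gives 4cx³, 2N/E gives 2x³, and
  -- replacing N by X costs |W|.
  refine ⟨8 + 4 * c + |W|, fun X hX => ?_⟩
  set x := X ^ (1 / 4 : ℝ) with hx
  have hX0 : 0 ≤ X := by linarith
  have hx1 : 1 ≤ x := Real.one_le_rpow hX (by norm_num)
  have hx4 : x ^ 4 = X := by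
    rw [hx, ← Real.rpow_natCast, ← Real.rpow_mul hX0]
    norm_num
  have hx3 : X ^ (3 / 4 : ℝ) = x ^ 3 := by
    rw [hx, ← Real.rpow_natCast, ← Real.rpow_mul hX0]
    norm_num
  have hx0 : 0 < x := by linarith
  set N := ⌊X⌋₊ with hN
  set Z := ⌊x⌋₊ with hZ
  -- The +1 secures N ≤ Y², so that (cY)² bounds every |a + bA|.
  set Y := ⌊x ^ 2⌋₊ + 1 with hY
  have hNX : (N : ℝ) ≤ X := Nat.floor_le hX0
  have hNX' : X < N + 1 := Nat.lt_floor_add_one X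
  have hZx : (Z : ℝ) ≤ x := Nat.floor_le hx0.le
  have hZx' : x < Z + 1 := Nat.lt_floor_add_one x
  have hZ1 : 1 ≤ Z := Nat.le_floor (by simpa using hx1)
  have hZ1' : (1 : ℝ) ≤ Z := by exact_mod_cast hZ1
  have hN1 : 1 ≤ N := Nat.le_floor (by simpa using hX)
  have hZN : Z ≤ N := Nat.floor_le_floor (by rw [← hx4]; exact le_self_pow₀ hx1 (by norm_num))
  have hYx : (Y : ℝ) ≤ 2 * x ^ 2 := by
    have h := Nat.floor_le (sq_nonneg x)
    rw [hY]
    push_cast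
    nlinarith
  have hYx' : x ^ 2 ≤ Y := by
    rw [hY]
    push_cast
    exact (Nat.lt_floor_add_one _).le
  have hNY : N ≤ Y ^ 2 := by
    have : (N : ℝ) ≤ (Y : ℝ) ^ 2 := hNX.trans (by rw [← hx4]; nlinarith)
    exact_mod_cast this
  have hE : ∀ A ∈ Finset.Ioc 0 N, (a + b * A).natAbs ≤ (c * Y) ^ 2 := by
    intro A hA
    have hAN := (Finset.mem_Ioc.1 hA).2
    calc (a + b * A).natAbs ≤ a.natAbs + b.natAbs * A := by
          refine (Int.natAbs_add_le _ _).trans ?_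
          rw [Int.natAbs_mul, Int.natAbs_natCast]
      _ ≤ a.natAbs * N + b.natAbs * N := by
          exact add_le_add (Nat.le_mul_of_pos_right _ hN1) (Nat.mul_le_mul_left _ hAN)
      _ = c * N := by rw [hc, add_mul]
      _ ≤ c ^ 2 * Y ^ 2 := Nat.mul_le_mul (Nat.le_self_pow two_ne_zero c) hNY
      _ = (c * Y) ^ 2 := by rw [mul_pow]
  have hcY : 0 < c * Y := Nat.mul_pos hc1 (Nat.succ_pos _)
  have h1 := abs_card_sievedSet_sub_le hκ hκT hT hb hab hZ1 hZN hE
  have h2 := abs_tsum_sieveWeight_sub_le (T := T) hκ hZ1 hcY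
  rw [← hW] at h2
  set B := ∑ x ∈ Finset.Ioc 0 Z ×ˢ Finset.Ioc 0 (c * Y), sieveWeight κ T x with hB
  set G := ((sievedSet κ T a b N).card : ℝ) with hG
  have hc1' : (1 : ℝ) ≤ c := by exact_mod_cast hc1
  have hY0 : (0 : ℝ) < Y := by positivity
  have hN0 : (0 : ℝ) ≤ N := Nat.cast_nonneg N
  have e1 : (N : ℝ) / Z ≤ 2 * x ^ 3 := by
    rw [div_le_iff₀ (by linarith)]
    calc (N : ℝ) ≤ x ^ 3 * x := by rw [← pow_succ, hx4]; exact hNX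
      _ ≤ x ^ 3 * (2 * Z) := by gcongr; linarith
      _ = _ := by ring
  have e2 : (N : ℝ) / ((c * Y : ℕ) : ℝ) ≤ x ^ 3 := by
    push_cast
    rw [div_le_iff₀ (by positivity)]
    calc (N : ℝ) ≤ x ^ 2 * (1 * x ^ 2) := by rw [one_mul, ← pow_add, hx4]; exact hNX
      _ ≤ x ^ 3 * (c * Y) := by
        gcongr
        norm_num
  have e3 : (Z : ℝ) * ((c * Y : ℕ) : ℝ) ≤ 2 * c * x ^ 3 := by
    push_cast
    calc (Z : ℝ) * (c * Y) ≤ x * (c * (2 * x ^ 2)) := by gcongr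
      _ = _ := by ring
  have e4 : |W| ≤ |W| * x ^ 3 := le_mul_of_one_le_right (abs_nonneg _) (one_le_pow₀ hx1)
  have e5 : |(N : ℝ) * (W - B)| ≤ 2 * (N / Z) + 2 * (N / ((c * Y : ℕ) : ℝ)) := by
    rw [abs_mul, abs_of_nonneg hN0]
    refine (mul_le_mul_of_nonneg_left h2 hN0).trans (le_of_eq ?_)
    ring
  have e6 : |(N - X) * W| ≤ |W| := by
    rw [abs_mul]
    refine mul_le_of_le_one_left (abs_nonneg _) ?_
    rw [abs_le]
    constructor <;> linarith
  have e7 : G - W * X = (G - N * B) - N * (W - B) + (N - X) * W := by ring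
  rw [hx3, e7]
  refine (abs_add_le _ _).trans ((add_le_add ((abs_sub _ _).trans (add_le_add h1 e5)) e6).trans ?_)
  linarith

/-! ### From the sieve to the theorem -/

/-- The value A = 1 has no Eisenstein prime and escapes the criterion; it changes the count by at
most 1. -/
theorem abs_ncard_sub_card_le_one {M : Set ℕ} {S : Finset ℕ} (h1 : M ⊆ S)
    (h2 : ∀ A ∈ S, A ≠ 1 → A ∈ M) : |(M.ncard : ℝ) - S.card| ≤ 1 := by
  have hfin : M.Finite := S.finite_toSet.subset h1
  have h3 : M.ncard ≤ S.card := by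
    rw [← Set.ncard_coe_finset]
    exact Set.ncard_le_ncard h1 S.finite_toSet
  have h4 : S.card ≤ M.ncard + 1 := by
    rw [← Set.ncard_coe_finset]
    refine (Set.ncard_le_ncard (t := insert 1 M) (fun A hA => ?_) (hfin.insert 1)).trans
      (Set.ncard_insert_le _ _)
    by_cases hA1 : A = 1
    · exact Or.inl hA1
    · exact Or.inr (h2 A hA hA1)
  have h3' : (M.ncard : ℝ) ≤ S.card := by exact_mod_cast h3
  have h4' : (S.card : ℝ) ≤ M.ncard + 1 := by exact_mod_cast h4
  rw [abs_le]
  constructor <;> linarith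

theorem exists_abs_ncard_sub_le {M : ℝ → Set ℕ} {S : ℕ → Finset ℕ} {W K : ℝ}
    (hK : ∀ X : ℝ, 1 ≤ X → |((S ⌊X⌋₊).card : ℝ) - W * X| ≤ K * X ^ (3 / 4 : ℝ))
    (h1 : ∀ X : ℝ, 1 ≤ X → M X ⊆ S ⌊X⌋₊)
    (h2 : ∀ X : ℝ, 1 ≤ X → ∀ A ∈ S ⌊X⌋₊, A ≠ 1 → A ∈ M X) :
    ∃ K : ℝ, ∀ X : ℝ, 1 ≤ X → |((M X).ncard : ℝ) - W * X| ≤ K * X ^ (3 / 4 : ℝ) := by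
  refine ⟨1 + K, fun X hX => ?_⟩
  have h3 := abs_ncard_sub_card_le_one (h1 X hX) (h2 X hX)
  have h4 : 1 ≤ X ^ (3 / 4 : ℝ) := Real.one_le_rpow hX (by norm_num)
  have h5 := hK X hX
  have h6 := abs_sub_le ((M X).ncard : ℝ) (S ⌊X⌋₊).card (W * X)
  linarith

theorem squarefree_squarefreeKernel (m : ℕ) : Squarefree (squarefreeKernel m) :=
  UniqueFactorizationMonoid.squarefree_radical

theorem theorem1p1 (n m : ℕ) (hn : 2 ≤ n) (hmn : m ∣ n) (hm : m < n) :
    Multipliable (fun p : outerPrimes n m => eulerFactor (p : ℕ)) ∧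
    (∃ K : ℝ, ∀ X : ℝ, 1 ≤ X →
      |(countMonogenic n m X : ℝ) - densityConst n m * X| ≤ K * X ^ (3 / 4 : ℝ)) ∧
    (3 ≤ n → ∃ K : ℝ, ∀ X : ℝ, 1 ≤ X →
      |(countMonogenicNonSquarefree n m X : ℝ) - densityConst n m * X| ≤
        K * X ^ (3 / 4 : ℝ)) := by
  obtain ⟨t, rfl⟩ := hmn
  have hm0 : m ≠ 0 := by rintro rfl; simp at hm
  have ht : 2 ≤ t := by
    by_contra h
    have : m * t ≤ m * 1 := Nat.mul_le_mul_left m (by omega)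
    omega
  have hdiv : m * t / m = t := Nat.mul_div_cancel_left t (Nat.pos_of_ne_zero hm0)
  set κ := squarefreeKernel m with hκ
  have hκsq : Squarefree κ := squarefree_squarefreeKernel m
  set T := t * (t - 1) * κ with hT
  have hκT : κ ∣ T := dvd_mul_left _ _
  have hT0 : T ≠ 0 := mul_ne_zero (mul_ne_zero (by omega) (by omega)) hκsq.ne_zero
  -- The sieve is run with a = t^t, b = (1-t)^(t-1) and T = t(t-1)κ, so that a prime dividing a or b
  -- divides T.
  have hdens : densityConst (m * t) m = ∑' x, sieveWeight κ T x := by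
    rw [tsum_sieveWeight_eq hκsq hκT, densityConst, outerPrimes, hdiv]
  have hb : (1 - (t : ℤ)) ^ (t - 1) ≠ 0 := pow_ne_zero _ (by omega)
  have hab : ∀ p : ℕ, p.Prime → ¬ p ∣ T →
      ¬ (p : ℤ) ∣ (t : ℤ) ^ t ∧ ¬ (p : ℤ) ∣ (1 - (t : ℤ)) ^ (t - 1) := by
    intro p hp hpT
    have hpz := Nat.prime_iff_prime_int.1 hp
    refine ⟨fun h => hpT ?_, fun h => hpT ?_⟩
    · exact ((Int.natCast_dvd_natCast.1 (hpz.dvd_of_dvd_pow h)).mul_right _).mul_right _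
    · refine Dvd.dvd.mul_right (Dvd.dvd.mul_left ?_ _) _
      rw [← Int.natCast_dvd_natCast, Nat.cast_sub (by omega)]
      exact dvd_sub_comm.1 (by simpa using hpz.dvd_of_dvd_pow h)
  obtain ⟨K, hK⟩ := exists_abs_card_sievedSet_sub_le hκsq.ne_zero hκT hT0 hb hab
  rw [hdens]
  have hmem : ∀ X : ℝ, 1 ≤ X → ∀ A : ℕ, 0 < A → (A : ℝ) ≤ X → κ ∣ A →
      IsMonogenicPoly (trinomialAA (m * t) m A) →
      A ∈ sievedSet κ T (t ^ t) ((1 - t) ^ (t - 1)) ⌊X⌋₊ := by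
    intro X _ A hA0 hAX hκA hA
    exact mem_sievedSet.2 ⟨Finset.mem_Ioc.2 ⟨hA0, Nat.le_floor hAX⟩, hκA,
      squarefree_of_isMonogenicPoly_trinomialAA hn hm hA,
      fun p hp hpT => not_sq_dvd_of_isMonogenicPoly_trinomialAA hm0 ht hA hp hpT⟩
  have hmono : ∀ X : ℝ, 1 ≤ X → ∀ A ∈ sievedSet κ T (t ^ t) ((1 - t) ^ (t - 1)) ⌊X⌋₊, A ≠ 1 →
      2 ≤ A ∧ (A : ℝ) ≤ X ∧ κ ∣ A ∧ IsMonogenicPoly (trinomialAA (m * t) m A) := by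
    intro X hX A hA hA1
    obtain ⟨hA2, hκA, hsq, hp⟩ := mem_sievedSet.1 hA
    obtain ⟨hA3, hA4⟩ := Finset.mem_Ioc.1 hA2
    have hA5 : 2 ≤ A := by omega
    exact ⟨hA5, (Nat.le_floor_iff (by linarith)).1 hA4, hκA,
      isMonogenicPoly_trinomialAA hm0 ht hA5 hκA hsq hp⟩
  refine ⟨multipliable_eulerFactor _ fun p hp => hp.1.two_le, ?_, fun hn3 => ?_⟩
  · refine exists_abs_ncard_sub_le hK (fun X hX A hA => ?_) fun X hX A hA hA1 => ?_
    · exact hmem X hX A hA.1 hA.2.1 hA.2.2.1 hA.2.2.2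
    · obtain ⟨h1, h2, h3, h4⟩ := hmono X hX A hA hA1
      exact ⟨by omega, h2, h3, h4⟩
  · refine exists_abs_ncard_sub_le hK (fun X hX A hA => ?_) fun X hX A hA hA1 => ?_
    · exact hmem X hX A hA.1 hA.2.1 hA.2.2.1 hA.2.2.2.1
    · obtain ⟨h1, h2, h3, h4⟩ := hmono X hX A hA hA1
      exact ⟨by omega, h2, h3, h4, not_squarefree_discr_trinomialAA hm0 hm hn3 h1⟩
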